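/- For $a>\tfrac12$ put $A_a(s)^2=a\cosh(2s)+\tfrac12$, $B_a(s)^2=a\cosh(2s)-\tfrac12$ with $A_a,B_a>0$, $K(a)=\sqrt{a^2-\tfrac14}$ and $\varphi_a(s)=\int_0^s\frac{K(a)}{A_a(t)^2B_a(t)}\,dt$. In $\mathbb R^4$ with the Lorentz product $\langle x,y\rangle_L=-x_0y_0+x_1y_1+x_2y_2+x_3y_3$ and hyperbolic space $\mathbb H^3=\{\langle x,x\rangle_L=-1,\ x_0>0\}$, consider the minimal immersion $$X_a(s,\theta)=\bigl(A_a\cosh\varphi_a,\ A_a\sinh\varphi_a,\ B_a\cos\theta,\ B_a\sin\theta\bigr)(s),$$ with the unit normal $\nu_a$ in $\mathbb H^3$ given by $$\nu_a=\Bigl(\tfrac{K\cosh\varphi_a}{A_a}-\tfrac{a\sinh(2s)\sinh\varphi_a}{A_aB_a},\ \tfrac{K\sinh\varphi_a}{A_a}-\tfrac{a\sinh(2s)\cosh\varphi_a}{A_aB_a},\ \tfrac{K}{B_a}\cos\theta,\ \tfrac{K}{B_a}\sin\theta\Bigr).$$ Let $s_0(a)>0$ be the unique positive solution of the free boundary condition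 $\tanh\varphi_a(s)=\dfrac{B_a(s)K(a)}{a\sinh(2s)}$, let $r(a)$ be the hyperbolic distance from $(1,0,0,0)$ to $X_a(s_0(a),0)$, and let $\phi_a(s)=\langle\partial_aX_a(s,\theta),\nu_a(s,\theta)\rangle_L$, where $\partial_a$ is taken at fixed $(s,\theta)$ (the value does not depend on $\theta$). Let $|\mathrm{II}|^2$ be the squared norm of the second fundamental form of $X_a$. Let $\mu_0(0)\le\mu_1(0)\le\mu_2(0)\le\cdots$ be the eigenvalues, counted with multiplicity and taken with respect to the inner product $\int_{-s_0(a)}^{s_0(a)}B_a\,u\,v\,ds$, of the mode-$0$ radial Robin quadratic form $$\mathcal S_0^{\mathrm{rad}}(u,u)=\int_{-s_0(a)}^{s_0(a)}\bigl[B_a(u')^2-B_a(|\mathrm{II}|^2-2)u^2\bigr]\,ds-\coth r(a)\,B_a(s_0(a))\bigl[u(s_0(a))^2+u(-s_0(a))^2\bigr].$$ **Theorem.** Let $a>\tfrac12$ be such that $\sinh r(a)>2K(a)$ and $\phi_a(s)>0$ for every $s\in[0,s_0(a)]$. Then $r$ is differentiable at $a$, $r'(a)>0$, and $\mu_2(0)>0$.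 -/

import Mathlib

open Real Set

noncomputable section

namespace HypCatenoid

/-- Lorentz inner product on `ℝ⁴` with signature `(-,+,+,+)`. Hyperbolic space is the sheet
`⟨x, x⟩ = -1`, `x 0 > 0`. -/
def lorentz (x y : Fin 4 → ℝ) : ℝ :=
  -(x 0 * y 0) + x 1 * y 1 + x 2 * y 2 + x 3 * y 3

/-- The pole of hyperbolic space. -/
def pole : Fin 4 → ℝ := ![1, 0, 0, 0]

/-- Hyperbolic distance of a point of hyperbolic space to the pole:
`cosh (distPole p) = -⟨p, pole⟩`. -/
def distPole (p : Fin 4 → ℝ) : ℝ := arcosh (-lorentz p pole)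

def A (a s : ℝ) : ℝ := √(a * cosh (2 * s) + 1 / 2)

def B (a s : ℝ) : ℝ := √(a * cosh (2 * s) - 1 / 2)

def K (a : ℝ) : ℝ := √(a ^ 2 - 1 / 4)

/-- The angle with `ang a 0 = 0` and `s`-derivative `K / (A² B)`. -/
def ang (a s : ℝ) : ℝ := ∫ t in (0 : ℝ)..s, K a / (A a t ^ 2 * B a t)

/-- The immersion of the rotational minimal surface with parameter `a`. -/
def X (a s θ : ℝ) : Fin 4 → ℝ :=
  ![A a s * cosh (ang a s), A a s * sinh (ang a s), B a s * cos θ, B a s * sin θ]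

theorem A_arg_pos {a : ℝ} (ha : 1 / 2 < a) (s : ℝ) : 0 < a * cosh (2 * s) + 1 / 2 := by
  nlinarith [one_le_cosh (2 * s)]

theorem B_arg_pos {a : ℝ} (ha : 1 / 2 < a) (s : ℝ) : 0 < a * cosh (2 * s) - 1 / 2 := by
  nlinarith [one_le_cosh (2 * s)]

theorem A_pos {a : ℝ} (ha : 1 / 2 < a) (s : ℝ) : 0 < A a s := sqrt_pos.2 (A_arg_pos ha s)

theorem B_pos {a : ℝ} (ha : 1 / 2 < a) (s : ℝ) : 0 < B a s := sqrt_pos.2 (B_arg_pos ha s)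

theorem A_sq {a : ℝ} (ha : 1 / 2 < a) (s : ℝ) : A a s ^ 2 = a * cosh (2 * s) + 1 / 2 :=
  sq_sqrt (A_arg_pos ha s).le

theorem B_sq {a : ℝ} (ha : 1 / 2 < a) (s : ℝ) : B a s ^ 2 = a * cosh (2 * s) - 1 / 2 :=
  sq_sqrt (B_arg_pos ha s).le

theorem K_sq {a : ℝ} (ha : 1 / 2 < a) : K a ^ 2 = a ^ 2 - 1 / 4 :=
  sq_sqrt (by nlinarith)

theorem hasDerivAt_A {a : ℝ} (ha : 1 / 2 < a) (s : ℝ) :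
    HasDerivAt (A a) (a * sinh (2 * s) / A a s) s := by
  have h : HasDerivAt (fun t : ℝ => a * cosh (2 * t) + 1 / 2) (a * (sinh (2 * s) * 2)) s := by
    have h2 : HasDerivAt (fun t : ℝ => 2 * t) 2 s := by
      simpa using (hasDerivAt_id s).const_mul 2
    exact (h2.cosh.const_mul a).add_const _
  have h1 : HasDerivAt (A a) (a * (sinh (2 * s) * 2) / (2 * A a s)) s :=
    h.sqrt (A_arg_pos ha s).ne'
  convert h1 using 1
  have := A_pos ha s
  field_simp

theorem hasDerivAt_B {a : ℝ} (ha : 1 / 2 < a) (s : ℝ) :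
    HasDerivAt (B a) (a * sinh (2 * s) / B a s) s := by
  have h : HasDerivAt (fun t : ℝ => a * cosh (2 * t) - 1 / 2) (a * (sinh (2 * s) * 2)) s := by
    have h2 : HasDerivAt (fun t : ℝ => 2 * t) 2 s := by
      simpa using (hasDerivAt_id s).const_mul 2
    exact (h2.cosh.const_mul a).sub_const _
  have h1 : HasDerivAt (B a) (a * (sinh (2 * s) * 2) / (2 * B a s)) s :=
    h.sqrt (B_arg_pos ha s).ne'
  convert h1 using 1
  have := B_pos ha s
  field_simp

theorem hasDerivAt_ang {a : ℝ} (ha : 1 / 2 < a) (s : ℝ) :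
    HasDerivAt (ang a) (K a / (A a s ^ 2 * B a s)) s := by
  have hc : Continuous fun t => K a / (A a t ^ 2 * B a t) := by
    have hA : Continuous (A a) :=
      continuous_iff_continuousAt.2 fun t => (hasDerivAt_A ha t).continuousAt
    have hB : Continuous (B a) :=
      continuous_iff_continuousAt.2 fun t => (hasDerivAt_B ha t).continuousAt
    refine continuous_const.div ((hA.pow 2).mul hB) fun t => ?_
    have := A_pos ha t
    have := B_pos ha t
    positivity
  exact hc.integral_hasStrictDerivAt 0 s |>.hasDerivAt

theorem hasDerivAt_X_s {a : ℝ} (ha : 1 / 2 < a) (s θ : ℝ) :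
    HasDerivAt (fun t => X a t θ)
      ![a * sinh (2 * s) / A a s * cosh (ang a s)
          + A a s * (sinh (ang a s) * (K a / (A a s ^ 2 * B a s))),
        a * sinh (2 * s) / A a s * sinh (ang a s)
          + A a s * (cosh (ang a s) * (K a / (A a s ^ 2 * B a s))),
        a * sinh (2 * s) / B a s * cos θ,
        a * sinh (2 * s) / B a s * sin θ] s := by
  rw [hasDerivAt_pi]
  intro i
  have h1 := hasDerivAt_A ha s
  have h2 := hasDerivAt_B ha s
  have h3 := hasDerivAt_ang ha s
  fin_cases i
  · exact h1.mul h3.cosh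
  · exact h1.mul h3.sinh
  · exact h2.mul_const _
  · exact h2.mul_const _

theorem hasDerivAt_X_theta (a s θ : ℝ) :
    HasDerivAt (fun τ => X a s τ) ![0, 0, B a s * -sin θ, B a s * cos θ] θ := by
  rw [hasDerivAt_pi]
  intro i
  fin_cases i
  · exact hasDerivAt_const _ _
  · exact hasDerivAt_const _ _
  · exact (hasDerivAt_cos θ).const_mul _
  · exact (hasDerivAt_sin θ).const_mul _

/-- The unit normal of the immersion in hyperbolic space, oriented so that its third coordinate
at `θ = 0` is positive; see `lorentz_normal_self`, `lorentz_normal_X`, `lorentz_normal_deriv_s`,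
`lorentz_normal_deriv_theta`. -/
def normal (a s θ : ℝ) : Fin 4 → ℝ :=
  ![K a * cosh (ang a s) / A a s - a * sinh (2 * s) * sinh (ang a s) / (A a s * B a s),
    K a * sinh (ang a s) / A a s - a * sinh (2 * s) * cosh (ang a s) / (A a s * B a s),
    K a / B a s * cos θ,
    K a / B a s * sin θ]

theorem lorentz_normal_self {a : ℝ} (ha : 1 / 2 < a) (s θ : ℝ) :
    lorentz (normal a s θ) (normal a s θ) = 1 := by
  have hA := A_pos ha s
  have hB := B_pos ha s
  have h1 := A_sq ha s
  have h2 := B_sq ha s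
  have h3 := K_sq ha
  have h4 := cosh_sq (ang a s)
  have h5 := sinh_sq (2 * s)
  have h6 := sin_sq_add_cos_sq θ
  simp only [lorentz, normal, Matrix.cons_val]
  have e : -(K a * cosh (ang a s) / A a s - a * sinh (2 * s) * sinh (ang a s) / (A a s * B a s)) ^ 2
      + (K a * sinh (ang a s) / A a s - a * sinh (2 * s) * cosh (ang a s) / (A a s * B a s)) ^ 2
      + K a ^ 2 / B a s ^ 2 = 1 := by
    field_simp
    have : A a s ^ 2 = B a s ^ 2 + 1 := by linarith
    have h7 : A a s ^ 2 * B a s ^ 2 = a ^ 2 * sinh (2 * s) ^ 2 + K a ^ 2 := by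
      rw [h1, h2, h3, h5]; ring
    linear_combination (a ^ 2 * sinh (2 * s) ^ 2 - K a ^ 2 * B a s ^ 2) * h4 + K a ^ 2 * this - h7
  linear_combination e + K a ^ 2 / B a s ^ 2 * h6

theorem lorentz_normal_X {a : ℝ} (ha : 1 / 2 < a) (s θ : ℝ) :
    lorentz (X a s θ) (normal a s θ) = 0 := by
  have hA := A_pos ha s
  have hB := B_pos ha s
  have h4 := cosh_sq (ang a s)
  have h6 := sin_sq_add_cos_sq θ
  simp only [lorentz, normal, X, Matrix.cons_val]
  field_simp
  linear_combination K a * B a s * h6 - K a * B a s * h4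

theorem lorentz_normal_deriv_s {a : ℝ} (ha : 1 / 2 < a) (s θ : ℝ) :
    lorentz (deriv (fun t => X a t θ) s) (normal a s θ) = 0 := by
  have hA := A_pos ha s
  have hB := B_pos ha s
  have h4 := cosh_sq (ang a s)
  have h6 := sin_sq_add_cos_sq θ
  have : A a s ^ 2 = B a s ^ 2 + 1 := by linarith [A_sq ha s, B_sq ha s]
  rw [(hasDerivAt_X_s ha s θ).deriv]
  simp only [lorentz, normal, Matrix.cons_val]
  have e : K a * a * sinh (2 * s) * (- 1 / A a s ^ 2 - 1 / (A a s ^ 2 * B a s ^ 2)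
      + 1 / B a s ^ 2) = 0 := by
    field_simp
    linear_combination K a * a * sinh (2 * s) * this
  have hs : ∀ x, A a s * (x * (K a / (A a s ^ 2 * B a s))) = x * (K a / (A a s * B a s)) := by
    intro x
    field_simp
  rw [hs, hs]
  linear_combination e + K a * a * sinh (2 * s) / B a s ^ 2 * h6
    - K a * a * sinh (2 * s) * (1 / A a s ^ 2 + 1 / (A a s ^ 2 * B a s ^ 2)) * h4

theorem lorentz_normal_deriv_theta (a s θ : ℝ) :
    lorentz (deriv (fun τ => X a s τ) θ) (normal a s θ) = 0 := by
  rw [(hasDerivAt_X_theta a s θ).deriv]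
  simp only [lorentz, normal, Matrix.cons_val]
  ring

/-- The free boundary condition at the parameter `s`. -/
def FreeBoundary (a s : ℝ) : Prop :=
  tanh (ang a s) = B a s * K a / (a * sinh (2 * s))

/-- The positive solution of the free boundary condition. For `a > 1/2` it exists and is unique,
because `tanh (ang a s)` increases from `0` to a positive limit and the right-hand side decreases
from `∞` to `0`. -/
def s₀ (a : ℝ) : ℝ := sInf {s : ℝ | 0 < s ∧ FreeBoundary a s}

/-- The radius of the geodesic ball in which the piece `|s| ≤ s₀ a` is a free boundary minimal
surface. -/
def radius (a : ℝ) : ℝ := distPole (X a (s₀ a) 0)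

/-- The normal component of the variation of the immersion in the parameter `a`, at fixed
`(s, θ)`. By rotational symmetry it does not depend on `θ`. -/
def paramJacobi (a s θ : ℝ) : ℝ :=
  lorentz (deriv (fun b => X b s θ) a) (normal a s θ)

/-- First fundamental form in the coordinates `(s, θ)`. -/
def firstForm (a s θ : ℝ) : Matrix (Fin 2) (Fin 2) ℝ :=
  let Xs := deriv (fun t => X a t θ) s
  let Xθ := deriv (fun τ => X a s τ) θ
  !![lorentz Xs Xs, lorentz Xs Xθ; lorentz Xθ Xs, lorentz Xθ Xθ]

/-- Second fundamental form in the coordinates `(s, θ)`: the normal components of the second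
derivatives of the immersion. (The normal of the surface in hyperbolic space is orthogonal to the
position vector, so ambient derivatives in `ℝ⁴` give the right value.) -/
def secondForm (a s θ : ℝ) : Matrix (Fin 2) (Fin 2) ℝ :=
  let Xss := deriv (fun t => deriv (fun t' => X a t' θ) t) s
  let Xsθ := deriv (fun τ => deriv (fun t => X a t τ) s) θ
  let Xθθ := deriv (fun τ => deriv (fun τ' => X a s τ') τ) θ
  !![lorentz Xss (normal a s θ), lorentz Xsθ (normal a s θ);
     lorentz Xsθ (normal a s θ), lorentz Xθθ (normal a s θ)]

/-- Squared norm of the second fundamental form, the trace of the square of the shape operator. -/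
def normSqII (a s θ : ℝ) : ℝ :=
  Matrix.trace (((firstForm a s θ)⁻¹ * secondForm a s θ) ^ 2)

/-- Radial potential of the Jacobi operator in Fourier mode `k`. By rotational symmetry the
squared norm of the second fundamental form does not depend on `θ`; it is evaluated at
`θ = 0`. -/
def W (k : ℤ) (a s : ℝ) : ℝ := normSqII a s 0 - 2 - (k : ℝ) ^ 2 / B a s ^ 2

/-- The bilinear form of the radial Robin quadratic form of mode `k` on `[-s₀ a, s₀ a]`. -/
def radForm (k : ℤ) (a : ℝ) (u v : ℝ → ℝ) : ℝ :=
  (∫ s in (-s₀ a)..(s₀ a), (B a s * (deriv u s * deriv v s) - B a s * W k a s * (u s * v s)))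
    - cosh (radius a) / sinh (radius a) * B a (s₀ a)
      * (u (s₀ a) * v (s₀ a) + u (-s₀ a) * v (-s₀ a))

/-- Radial `L²` inner product with respect to the area element `B ds dθ` (up to the factor
from `θ`). -/
def radInner (a : ℝ) (u v : ℝ → ℝ) : ℝ := ∫ s in (-s₀ a)..(s₀ a), B a s * (u s * v s)

/-- `u` is of class `C²` on `[-s₀ a, s₀ a]` and satisfies the eigenvalue equation
`𝒮ₖ(u, v) = μ (u, v)` for all `C²` test functions `v`. After integration by parts this says
`-(B u')' - B W u = μ B u` with the Robin conditions `u' = ± coth r u` at `± s₀`. Nontriviality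
of `u` is imposed in `HasEigenvaluesLE`. -/
def IsEigenfunction (k : ℤ) (a μ : ℝ) (u : ℝ → ℝ) : Prop :=
  ContDiffOn ℝ 2 u (Icc (-s₀ a) (s₀ a)) ∧
    ∀ v : ℝ → ℝ, ContDiffOn ℝ 2 v (Icc (-s₀ a) (s₀ a)) →
      radForm k a u v = μ * radInner a u v

/-- The form of mode `k` has at least `m` eigenvalues `≤ x`, counted with multiplicity: there are
`m` eigenfunctions with eigenvalues `≤ x`, linearly independent as functions on
`[-s₀ a, s₀ a]`. -/
def HasEigenvaluesLE (k : ℤ) (a : ℝ) (m : ℕ) (x : ℝ) : Prop :=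
  ∃ (ev : Fin m → ℝ) (u : Fin m → ℝ → ℝ),
    (∀ i, ev i ≤ x ∧ IsEigenfunction k a (ev i) (u i)) ∧
      LinearIndependent ℝ (fun i => (Icc (-s₀ a) (s₀ a)).domRestrict (u i))

/-- The `(n+1)`-th eigenvalue of the form of mode `k`, in increasing order and counted with
multiplicity: the least `x` such that there are at least `n + 1` eigenvalues `≤ x`. -/
def eigenvalue (k : ℤ) (a : ℝ) (n : ℕ) : ℝ := sInf {x : ℝ | HasEigenvaluesLE k a (n + 1) x}

end HypCatenoid

end

/-!
Write `φ` for the Jacobi function `paramJacobi` of the family and `K`, `A`, `B`, `Φ = ∂ₐ ang` as in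
the definitions. Everything reduces to the closed form (`paramJacobi_eq`)
`φ = K cosh (2 s) / (2 A² B²) - B' Φ` and the first integral `B² B'² = B⁴ + B² - K²`.

*The radius.* The free boundary condition reads `B' tanh (ang) = K`, whose left side increases in
`s`; hence `s₀` is its only positive solution and is differentiable by the implicit function
theorem (`hasDerivAt_s₀`). Differentiating `cosh radius = A cosh (ang)` along `s₀` gives, up to a
positive factor, `(B² - 2 K²) φ + a B² / K` at `s₀` (`height_deriv_pos`). The first bracket is
positive: while `B² ≤ 2 K²`, one has `B' ≤ √2 a`, and an explicit bound of the angle by an inverse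
hyperbolic sine shows `√2 a tanh (ang) < K` (`two_mul_K_sq_lt`).

*The third eigenvalue.* Since `φ` is even, positive and solves the Jacobi equation
`(B φ')' + B W φ = 0` (`hasDerivAt_jacFlux`), a Riccati argument bounds the form below by a positive
multiple `δ` of the inner product on functions vanishing at both endpoints
(`exists_dirichlet_gap`). Three independent eigenfunctions with eigenvalues at most `x` have a
nonzero combination that vanishes at both endpoints, and on their span the form is at most `x` times
the inner product; so `δ ≤ x` (`le_of_hasEigenvaluesLE`).

*Existence of eigenvalues.* The infimum that defines `eigenvalue` would be `0` if there were fewer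
than three eigenvalues. After the substitution `u = v / √B` the eigenvalue equation is
`v'' = (q - k²) v`. For large `k` the solution of the initial value problem is a Neumann series of a
Volterra operator and depends continuously on `k`, and its boundary defect is `-k sin (k T) + O(1)`,
so the intermediate value theorem gives arbitrarily large eigenvalues (`exists_robin_solution`).
-/

noncomputable section

namespace HypCatenoid

/-! ### Robin eigenvalue problems on an interval -/

section Neumann

variable {E : Type*} [NormedAddCommGroup E] [NormedSpace ℝ E]

theorem norm_smul_comp_sub_comp_le {c D : ℝ} (hc : 0 ≤ c) {L₁ L₂ P₁ P₂ : E →L[ℝ] E}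
    (h₁ : ‖L₁‖ ≤ 1) (h₂ : ‖L₂‖ ≤ 1) (h₃ : ‖P₁‖ ≤ D) (h₄ : ‖P₂‖ ≤ D) :
    ‖c • (L₁ ∘L P₁ - L₂ ∘L P₂)‖ ≤ c * (2 * D) := by
  rw [norm_smul, norm_of_nonneg hc]
  have h5 := (ContinuousLinearMap.opNorm_comp_le L₁ P₁).trans
    (mul_le_mul h₁ h₃ (norm_nonneg _) zero_le_one)
  have h6 := (ContinuousLinearMap.opNorm_comp_le L₂ P₂).trans
    (mul_le_mul h₂ h₄ (norm_nonneg _) zero_le_one)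
  gcongr
  refine (norm_sub_le _ _).trans ?_
  linarith

variable [CompleteSpace E]

theorem inverse_one_sub_apply_eq {V : E →L[ℝ] E} (hV : ‖V‖ ≤ 1 / 2) (f : E) :
    Ring.inverse (1 - V) f = f + V (Ring.inverse (1 - V) f) := by
  have hu : IsUnit (1 - V) := isUnit_one_sub_of_norm_lt_one (hV.trans_lt (by norm_num))
  have := congrArg (fun L : E →L[ℝ] E => L f) (Ring.mul_inverse_cancel _ hu)
  change (1 - V) (Ring.inverse (1 - V) f) = f at this
  nth_rw 2 [← this]
  simp

theorem continuousAt_inverse_one_sub_apply {V : ℝ → E →L[ℝ] E} {f : ℝ → E} {k : ℝ}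
    (hV : ‖V k‖ ≤ 1 / 2) (hc : ContinuousAt V k) (hf : ContinuousAt f k) :
    ContinuousAt (fun k => Ring.inverse (1 - V k) (f k)) k := by
  have hu : IsUnit (1 - V k) := isUnit_one_sub_of_norm_lt_one (hV.trans_lt (by norm_num))
  have h1 : ContinuousAt (fun k => Ring.inverse (1 - V k)) k :=
    ContinuousAt.comp (g := Ring.inverse) (f := fun k => 1 - V k)
      (by obtain ⟨u, hu⟩ := hu
          rw [← hu]
          exact NormedRing.inverse_continuousAt u)
      (continuousAt_const.sub hc)
  exact h1.clm_apply hf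

end Neumann

section Volterra

variable {T : ℝ} (hT : 0 < T)

/-- The primitive vanishing at `0`, as a bounded operator on `C([0, T])`. -/
def primitiveCLM : C(Icc (0 : ℝ) T, ℝ) →L[ℝ] C(Icc (0 : ℝ) T, ℝ) :=
  LinearMap.mkContinuous
    { toFun := fun f => ⟨fun s => ∫ t in (0 : ℝ)..s, IccExtend hT.le f t, by
        have : Continuous fun s : ℝ => ∫ t in (0 : ℝ)..s, IccExtend hT.le f t :=
          intervalIntegral.continuous_primitive
            (fun _ _ => (f.continuous.Icc_extend' (h := hT.le)).intervalIntegrable _ _) 0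
        exact this.comp continuous_subtype_val⟩
      map_add' := fun f g => by
        ext s
        exact intervalIntegral.integral_add
          ((f.continuous.Icc_extend' (h := hT.le)).intervalIntegrable _ _)
          ((g.continuous.Icc_extend' (h := hT.le)).intervalIntegrable _ _)
      map_smul' := fun c f => by
        ext s
        exact intervalIntegral.integral_const_mul c _ }
    T (fun f => by
      refine (ContinuousMap.norm_le _ (by positivity)).2 fun s => ?_
      have h := intervalIntegral.norm_integral_le_of_norm_le_const (a := (0 : ℝ)) (b := s)
        (f := IccExtend hT.le f) (C := ‖f‖) fun t _ => f.norm_coe_le_norm _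
      have h2 : |(s : ℝ) - 0| ≤ T := by
        rw [sub_zero, abs_of_nonneg s.2.1]
        exact s.2.2
      calc _ ≤ ‖f‖ * |(s : ℝ) - 0| := h
        _ ≤ ‖f‖ * T := by gcongr
        _ = T * ‖f‖ := mul_comm _ _)

theorem primitiveCLM_apply (f : C(Icc (0 : ℝ) T, ℝ)) (s : Icc (0 : ℝ) T) :
    primitiveCLM hT f s = ∫ t in (0 : ℝ)..s, IccExtend hT.le f t := rfl

theorem norm_primitiveCLM_le : ‖primitiveCLM hT‖ ≤ T :=
  LinearMap.mkContinuous_norm_le _ hT.le _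

/-- `s ↦ cos (k s)` as an element of `C([0, T])`. -/
def cosMap (T k : ℝ) : C(Icc (0 : ℝ) T, ℝ) := ⟨fun s => cos (k * s), by fun_prop⟩

/-- `s ↦ sin (k s)` as an element of `C([0, T])`. -/
def sinMap (T k : ℝ) : C(Icc (0 : ℝ) T, ℝ) := ⟨fun s => sin (k * s), by fun_prop⟩

theorem continuous_cosMap (T : ℝ) : Continuous (cosMap T) :=
  (ContinuousMap.curry (⟨fun p : ℝ × Icc (0 : ℝ) T => cos (p.1 * p.2), by fun_prop⟩ :
    C(ℝ × Icc (0 : ℝ) T, ℝ))).continuous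

theorem continuous_sinMap (T : ℝ) : Continuous (sinMap T) :=
  (ContinuousMap.curry (⟨fun p : ℝ × Icc (0 : ℝ) T => sin (p.1 * p.2), by fun_prop⟩ :
    C(ℝ × Icc (0 : ℝ) T, ℝ))).continuous

theorem norm_cosMap_le (T k : ℝ) : ‖cosMap T k‖ ≤ 1 :=
  (ContinuousMap.norm_le _ zero_le_one).2 fun _ => abs_cos_le_one _

theorem norm_sinMap_le (T k : ℝ) : ‖sinMap T k‖ ≤ 1 :=
  (ContinuousMap.norm_le _ zero_le_one).2 fun _ => abs_sin_le_one _

/-- The integral `s ↦ ∫₀ˢ cos (k t) q(t) v(t) dt` as an operator on `v`. -/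
def cosIntegral (q : C(Icc (0 : ℝ) T, ℝ)) (k : ℝ) :
    C(Icc (0 : ℝ) T, ℝ) →L[ℝ] C(Icc (0 : ℝ) T, ℝ) :=
  primitiveCLM hT ∘L ContinuousLinearMap.mul ℝ _ (cosMap T k * q)

/-- The integral `s ↦ ∫₀ˢ sin (k t) q(t) v(t) dt` as an operator on `v`. -/
def sinIntegral (q : C(Icc (0 : ℝ) T, ℝ)) (k : ℝ) :
    C(Icc (0 : ℝ) T, ℝ) →L[ℝ] C(Icc (0 : ℝ) T, ℝ) :=
  primitiveCLM hT ∘L ContinuousLinearMap.mul ℝ _ (sinMap T k * q)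

/-- The Volterra operator `v ↦ (s ↦ ∫₀ˢ k⁻¹ sin (k (s - t)) q(t) v(t) dt)` of the equation
`v'' = (q - k²) v`, with the kernel expanded by the addition theorem. -/
def volterra (q : C(Icc (0 : ℝ) T, ℝ)) (k : ℝ) :
    C(Icc (0 : ℝ) T, ℝ) →L[ℝ] C(Icc (0 : ℝ) T, ℝ) :=
  k⁻¹ • (ContinuousLinearMap.mul ℝ _ (sinMap T k) ∘L cosIntegral hT q k
    - ContinuousLinearMap.mul ℝ _ (cosMap T k) ∘L sinIntegral hT q k)

theorem continuous_cosIntegral (q : C(Icc (0 : ℝ) T, ℝ)) : Continuous (cosIntegral hT q) := by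
  have := continuous_cosMap T
  unfold cosIntegral
  exact continuous_const.clm_comp
    ((ContinuousLinearMap.mul ℝ _).continuous.comp (this.mul continuous_const))

theorem continuous_sinIntegral (q : C(Icc (0 : ℝ) T, ℝ)) : Continuous (sinIntegral hT q) := by
  have := continuous_sinMap T
  unfold sinIntegral
  exact continuous_const.clm_comp
    ((ContinuousLinearMap.mul ℝ _).continuous.comp (this.mul continuous_const))

theorem continuousAt_volterra (q : C(Icc (0 : ℝ) T, ℝ)) {k : ℝ} (hk : k ≠ 0) :
    ContinuousAt (volterra hT q) k := by
  unfold volterra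
  refine (continuousAt_inv₀ hk).smul (Continuous.continuousAt ?_)
  exact (((ContinuousLinearMap.mul ℝ _).continuous.comp (continuous_sinMap T)).clm_comp
    (continuous_cosIntegral hT q)).sub
      (((ContinuousLinearMap.mul ℝ _).continuous.comp (continuous_cosMap T)).clm_comp
        (continuous_sinIntegral hT q))

theorem norm_cosIntegral_le (q : C(Icc (0 : ℝ) T, ℝ)) (k : ℝ) :
    ‖cosIntegral hT q k‖ ≤ T * ‖q‖ := by
  refine (ContinuousLinearMap.opNorm_comp_le _ _).trans ?_
  have h1 : ‖ContinuousLinearMap.mul ℝ C(Icc (0 : ℝ) T, ℝ) (cosMap T k * q)‖ ≤ ‖q‖ := by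
    refine (ContinuousLinearMap.opNorm_mul_apply_le ℝ _ _).trans ((norm_mul_le _ _).trans ?_)
    nlinarith [norm_cosMap_le T k, norm_nonneg q]
  exact mul_le_mul (norm_primitiveCLM_le hT) h1 (norm_nonneg _) hT.le

theorem norm_sinIntegral_le (q : C(Icc (0 : ℝ) T, ℝ)) (k : ℝ) :
    ‖sinIntegral hT q k‖ ≤ T * ‖q‖ := by
  refine (ContinuousLinearMap.opNorm_comp_le _ _).trans ?_
  have h1 : ‖ContinuousLinearMap.mul ℝ C(Icc (0 : ℝ) T, ℝ) (sinMap T k * q)‖ ≤ ‖q‖ := by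
    refine (ContinuousLinearMap.opNorm_mul_apply_le ℝ _ _).trans ((norm_mul_le _ _).trans ?_)
    nlinarith [norm_sinMap_le T k, norm_nonneg q]
  exact mul_le_mul (norm_primitiveCLM_le hT) h1 (norm_nonneg _) hT.le

theorem norm_volterra_le (q : C(Icc (0 : ℝ) T, ℝ)) {k : ℝ} (hk : 0 < k) :
    ‖volterra hT q k‖ ≤ k⁻¹ * (2 * (T * ‖q‖)) := by
  have h1 : ‖ContinuousLinearMap.mul ℝ C(Icc (0 : ℝ) T, ℝ) (sinMap T k)‖ ≤ 1 :=
    (ContinuousLinearMap.opNorm_mul_apply_le ℝ _ _).trans (norm_sinMap_le T k)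
  have h2 : ‖ContinuousLinearMap.mul ℝ C(Icc (0 : ℝ) T, ℝ) (cosMap T k)‖ ≤ 1 :=
    (ContinuousLinearMap.opNorm_mul_apply_le ℝ _ _).trans (norm_cosMap_le T k)
  exact norm_smul_comp_sub_comp_le (inv_nonneg.2 hk.le) h1 h2
    (norm_cosIntegral_le hT q k) (norm_sinIntegral_le hT q k)

/-- The solution of `v'' = (q - k²) v`, `v(0) = 1`, `v'(0) = h`, for large `k`. -/
def volterraSol (q : C(Icc (0 : ℝ) T, ℝ)) (h k : ℝ) : C(Icc (0 : ℝ) T, ℝ) :=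
  Ring.inverse (1 - volterra hT q k) (cosMap T k + (h / k) • sinMap T k)

theorem norm_volterra_le_half (q : C(Icc (0 : ℝ) T, ℝ)) {k : ℝ} (hk : 0 < k)
    (hq : 4 * (T * ‖q‖) ≤ k) : ‖volterra hT q k‖ ≤ 1 / 2 := by
  refine (norm_volterra_le hT q hk).trans ?_
  rw [inv_mul_le_iff₀ hk]
  linarith

theorem volterraSol_eq (q : C(Icc (0 : ℝ) T, ℝ)) (h : ℝ) {k : ℝ} (hk : 0 < k)
    (hq : 4 * (T * ‖q‖) ≤ k) :
    volterraSol hT q h k = cosMap T k + (h / k) • sinMap T k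
      + volterra hT q k (volterraSol hT q h k) :=
  inverse_one_sub_apply_eq (norm_volterra_le_half hT q hk hq) _

theorem norm_volterraSol_le (q : C(Icc (0 : ℝ) T, ℝ)) (h : ℝ) {k : ℝ} (hk : 0 < k)
    (hq : 4 * (T * ‖q‖) ≤ k) (hh : |h| ≤ k) : ‖volterraSol hT q h k‖ ≤ 4 := by
  have h1 := congrArg norm (volterraSol_eq hT q h hk hq)
  have h2 := (volterra hT q k).le_opNorm (volterraSol hT q h k)
  have h3 : ‖(h / k) • sinMap T k‖ ≤ 1 := by
    rw [norm_smul, norm_eq_abs, abs_div, abs_of_pos hk]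
    have := norm_sinMap_le T k
    have h4 : |h| / k ≤ 1 := by rwa [div_le_one hk]
    exact mul_le_one₀ h4 (norm_nonneg _) this
  have h4 := norm_add_le (cosMap T k + (h / k) • sinMap T k)
    (volterra hT q k (volterraSol hT q h k))
  have h5 := norm_add_le (cosMap T k) ((h / k) • sinMap T k)
  have h6 := norm_cosMap_le T k
  have h7 := norm_volterra_le_half hT q hk hq
  nlinarith [norm_nonneg (volterraSol hT q h k)]

theorem continuousAt_volterraSol (q : C(Icc (0 : ℝ) T, ℝ)) (h : ℝ) {k : ℝ} (hk : 0 < k)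
    (hq : 4 * (T * ‖q‖) ≤ k) : ContinuousAt (volterraSol hT q h) k :=
  continuousAt_inverse_one_sub_apply (norm_volterra_le_half hT q hk hq)
    (continuousAt_volterra hT q hk.ne') ((continuous_cosMap T).continuousAt.add
      ((continuousAt_const.div continuousAt_id hk.ne').smul (continuous_sinMap T).continuousAt))

/-- The derivative at `T` of the solution `volterraSol`, minus `H` times its value there. Its zeros
`k` are the square roots of the large Robin eigenvalues. -/
def robinDefect (q : C(Icc (0 : ℝ) T, ℝ)) (h H k : ℝ) : ℝ :=
  -k * sin (k * T) + (h * cos (k * T)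
    + (cos (k * T) * cosIntegral hT q k (volterraSol hT q h k) ⟨T, hT.le, le_rfl⟩
    + sin (k * T) * sinIntegral hT q k (volterraSol hT q h k) ⟨T, hT.le, le_rfl⟩)
    - H * volterraSol hT q h k ⟨T, hT.le, le_rfl⟩)

theorem continuousAt_robinDefect (q : C(Icc (0 : ℝ) T, ℝ)) (h H : ℝ) {k : ℝ} (hk : 0 < k)
    (hq : 4 * (T * ‖q‖) ≤ k) : ContinuousAt (robinDefect hT q h H) k := by
  have h1 := continuousAt_volterraSol hT q h hk hq
  have ev : ∀ {f : ℝ → C(Icc (0 : ℝ) T, ℝ)}, ContinuousAt f k →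
      ContinuousAt (fun k => f k ⟨T, hT.le, le_rfl⟩) k := fun {f} hf =>
    (continuous_eval_const _).continuousAt.comp hf
  have h2 := ev ((continuous_cosIntegral hT q).continuousAt.clm_apply h1)
  have h3 := ev ((continuous_sinIntegral hT q).continuousAt.clm_apply h1)
  have h4 := ev h1
  unfold robinDefect
  fun_prop

theorem abs_robinDefect_add_le (q : C(Icc (0 : ℝ) T, ℝ)) (h H : ℝ) {k : ℝ} (hk : 0 < k)
    (hq : 4 * (T * ‖q‖) ≤ k) (hh : |h| ≤ k) :
    |robinDefect hT q h H k + k * sin (k * T)| ≤ |h| + 8 * (T * ‖q‖) + 4 * |H| := by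
  have h0 := norm_volterraSol_le hT q h hk hq hh
  have h1 : |volterraSol hT q h k ⟨T, hT.le, le_rfl⟩| ≤ 4 :=
    ((volterraSol hT q h k).norm_coe_le_norm _).trans h0
  have hTq : 0 ≤ T * ‖q‖ := by positivity
  have h2 : |cosIntegral hT q k (volterraSol hT q h k) ⟨T, hT.le, le_rfl⟩| ≤ T * ‖q‖ * 4 :=
    (ContinuousMap.norm_coe_le_norm _ _).trans (((cosIntegral hT q k).le_opNorm _).trans
      (mul_le_mul (norm_cosIntegral_le hT q k) h0 (norm_nonneg _) hTq))
  have h3 : |sinIntegral hT q k (volterraSol hT q h k) ⟨T, hT.le, le_rfl⟩| ≤ T * ‖q‖ * 4 :=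
    (ContinuousMap.norm_coe_le_norm _ _).trans (((sinIntegral hT q k).le_opNorm _).trans
      (mul_le_mul (norm_sinIntegral_le hT q k) h0 (norm_nonneg _) hTq))
  have hc := abs_cos_le_one (k * T)
  have hs := abs_sin_le_one (k * T)
  have e1 := mul_le_mul hc h2 (abs_nonneg _) zero_le_one
  have e2 := mul_le_mul hs h3 (abs_nonneg _) zero_le_one
  have e3 := mul_le_mul le_rfl h1 (abs_nonneg _) (abs_nonneg H)
  have e4 := mul_le_mul le_rfl hc (abs_nonneg _) (abs_nonneg h)
  rw [← abs_mul] at e1 e2 e3 e4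
  unfold robinDefect
  rw [abs_le] at *
  constructor <;> linarith [e1.1, e1.2, e2.1, e2.2, e3.1, e3.2, e4.1, e4.2]

theorem exists_robinDefect_eq_zero (q : C(Icc (0 : ℝ) T, ℝ)) (h H N : ℝ) :
    ∃ k, N < k ∧ 0 < k ∧ 4 * (T * ‖q‖) ≤ k ∧ robinDefect hT q h H k = 0 := by
  obtain ⟨n, hn⟩ := exists_nat_gt (T * (|N| + |h| + 8 * (T * ‖q‖) + 4 * |H| + 1))
  have hTq : 0 ≤ T * ‖q‖ := by positivity
  have hN := le_abs_self N
  have hπ := pi_gt_three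
  set D := |N| + |h| + 8 * (T * ‖q‖) + 4 * |H| + 1 with hD
  -- `k₁ T` and `k₂ T` are `π / 2` and `3 π / 2` modulo `2 π`, so that `sin` is `1` and `-1` there.
  set k₁ := (π / 2 + n * (2 * π)) / T with hk₁
  set k₂ := (π / 2 + n * (2 * π) + π) / T with hk₂
  have hn0 : (0 : ℝ) ≤ n := n.cast_nonneg
  have e1 : D < k₁ := by
    rw [hk₁, lt_div_iff₀ hT]
    nlinarith
  have e12 : k₁ < k₂ := by
    rw [hk₁, hk₂]
    exact div_lt_div_of_pos_right (by linarith) hT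
  have s1 : sin (k₁ * T) = 1 := by
    rw [hk₁, div_mul_cancel₀ _ hT.ne', sin_add_nat_mul_two_pi, sin_pi_div_two]
  have s2 : sin (k₂ * T) = -1 := by
    rw [hk₂, div_mul_cancel₀ _ hT.ne', sin_add_pi, sin_add_nat_mul_two_pi, sin_pi_div_two]
  have big : ∀ k, D < k → 0 < k ∧ 4 * (T * ‖q‖) ≤ k ∧ |h| ≤ k := fun k hk =>
    ⟨by linarith [abs_nonneg N, abs_nonneg h, abs_nonneg H],
      by linarith [abs_nonneg N, abs_nonneg h, abs_nonneg H],
      by linarith [abs_nonneg N, abs_nonneg h, abs_nonneg H]⟩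
  obtain ⟨a1, a2, a3⟩ := big k₁ e1
  obtain ⟨b1, b2, b3⟩ := big k₂ (e1.trans e12)
  have d1 := abs_le.1 (abs_robinDefect_add_le hT q h H a1 a2 a3)
  have d2 := abs_le.1 (abs_robinDefect_add_le hT q h H b1 b2 b3)
  rw [s1] at d1
  rw [s2] at d2
  have hc : ContinuousOn (robinDefect hT q h H) (Icc k₁ k₂) := fun k hk => by
    obtain ⟨c1, c2, -⟩ := big k (e1.trans_le hk.1)
    exact (continuousAt_robinDefect hT q h H c1 c2).continuousWithinAt
  have hz : (0 : ℝ) ∈ Icc (robinDefect hT q h H k₁) (robinDefect hT q h H k₂) :=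
    ⟨by linarith [abs_nonneg N, d1.2], by linarith [abs_nonneg N, d2.1]⟩
  obtain ⟨k, hk, hk0⟩ := intermediate_value_Icc e12.le hc hz
  obtain ⟨c1, c2, -⟩ := big k (e1.trans_le hk.1)
  exact ⟨k, by linarith [e1.trans_le hk.1, abs_nonneg h, abs_nonneg H], c1, c2, hk0⟩

end Volterra

/-- The Robin problem `v'' = (q - k²) v` on `[0, T]` with `v'(0) = h v(0)`, `v'(T) = H v(T)` has
solutions for arbitrarily large `k`: the boundary defect at `T` is `-k sin (k T) + O(1)`, which
changes sign infinitely often. -/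
theorem exists_robin_solution {q : ℝ → ℝ} (hq : Continuous q) {T : ℝ} (hT : 0 < T)
    (h H N : ℝ) :
    ∃ k, N < k ∧ 0 < k ∧ ∃ v v' v'' : ℝ → ℝ, Continuous v'' ∧ (∀ s, HasDerivAt v (v' s) s) ∧
      (∀ s, HasDerivAt v' (v'' s) s) ∧ (∀ s ∈ Icc 0 T, v'' s = (q s - k ^ 2) * v s) ∧
      v 0 = 1 ∧ v' 0 = h ∧ v' T = H * v T := by
  set qE : C(Icc (0 : ℝ) T, ℝ) := ⟨fun s => q s, hq.comp continuous_subtype_val⟩ with hqE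
  obtain ⟨k, hNk, hk, hkq, hF⟩ := exists_robinDefect_eq_zero hT qE h H N
  refine ⟨k, hNk, hk, ?_⟩
  set w := volterraSol hT qE h k with hw
  have hwe := volterraSol_eq hT qE h hk hkq
  rw [← hw] at hwe
  have hwc : Continuous (IccExtend hT.le w) := w.continuous.Icc_extend'
  set g : ℝ → ℝ := fun t => q t * IccExtend hT.le w t with hg
  have hgc : Continuous g := hq.mul hwc
  set Ic : ℝ → ℝ := fun s => ∫ t in (0 : ℝ)..s, cos (k * t) * g t with hIc
  set Is : ℝ → ℝ := fun s => ∫ t in (0 : ℝ)..s, sin (k * t) * g t with hIs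
  have dIc : ∀ s, HasDerivAt Ic (cos (k * s) * g s) s := fun s =>
    ((by fun_prop : Continuous fun t => cos (k * t) * g t).integral_hasStrictDerivAt 0 s).hasDerivAt
  have dIs : ∀ s, HasDerivAt Is (sin (k * s) * g s) s := fun s =>
    ((by fun_prop : Continuous fun t => sin (k * t) * g t).integral_hasStrictDerivAt 0 s).hasDerivAt
  have dlin : ∀ s, HasDerivAt (fun s : ℝ => k * s) k s := fun s => by
    simpa using (hasDerivAt_id s).const_mul k
  have dcos : ∀ s, HasDerivAt (fun s => cos (k * s)) (-sin (k * s) * k) s := fun s =>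
    (dlin s).cos
  have dsin : ∀ s, HasDerivAt (fun s => sin (k * s)) (cos (k * s) * k) s := fun s =>
    (dlin s).sin
  have ic : ∀ s (hs : s ∈ Icc 0 T), cosIntegral hT qE k w ⟨s, hs⟩ = Ic s := fun s hs => by
    simp only [cosIntegral, ContinuousLinearMap.comp_apply, primitiveCLM_apply, hIc]
    refine intervalIntegral.integral_congr fun t ht => ?_
    rw [uIcc_of_le hs.1] at ht
    have ht' : t ∈ Icc 0 T := ⟨ht.1, ht.2.trans hs.2⟩
    simp only [hg, IccExtend_of_mem hT.le _ ht']
    simp [cosMap, hqE, mul_assoc]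
  have is : ∀ s (hs : s ∈ Icc 0 T), sinIntegral hT qE k w ⟨s, hs⟩ = Is s := fun s hs => by
    simp only [sinIntegral, ContinuousLinearMap.comp_apply, primitiveCLM_apply, hIs]
    refine intervalIntegral.integral_congr fun t ht => ?_
    rw [uIcc_of_le hs.1] at ht
    have ht' : t ∈ Icc 0 T := ⟨ht.1, ht.2.trans hs.2⟩
    simp only [hg, IccExtend_of_mem hT.le _ ht']
    simp [sinMap, hqE, mul_assoc]
  set v : ℝ → ℝ := fun s => cos (k * s) + h / k * sin (k * s)
    + k⁻¹ * (sin (k * s) * Ic s - cos (k * s) * Is s) with hv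
  have vw : ∀ s (hs : s ∈ Icc 0 T), w ⟨s, hs⟩ = v s := fun s hs => by
    have := congrArg (fun f : C(Icc (0 : ℝ) T, ℝ) => f ⟨s, hs⟩) hwe
    simp only [volterra, ContinuousMap.add_apply, ContinuousMap.smul_apply,
      smul_apply, sub_apply, ContinuousMap.sub_apply,
      ContinuousLinearMap.comp_apply, ContinuousLinearMap.mul_apply', ContinuousMap.mul_apply,
      ic s hs, is s hs, smul_eq_mul] at this
    rw [this]
    rfl
  refine ⟨v, fun s => -k * sin (k * s) + h * cos (k * s) + (cos (k * s) * Ic s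
    + sin (k * s) * Is s), fun s => g s - k ^ 2 * v s, ?_, ?_, ?_, ?_, ?_, ?_, ?_⟩
  · have : Continuous Ic := continuous_iff_continuousAt.2 fun s => (dIc s).continuousAt
    have : Continuous Is := continuous_iff_continuousAt.2 fun s => (dIs s).continuousAt
    fun_prop
  · intro s
    have := ((dcos s).add ((dsin s).const_mul (h / k))).add
      ((((dsin s).mul (dIc s)).sub ((dcos s).mul (dIs s))).const_mul k⁻¹)
    refine this.congr_deriv ?_
    field_simp
    ring
  · intro s
    have := (((dsin s).const_mul (-k)).add ((dcos s).const_mul h)).add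
      (((dcos s).mul (dIc s)).add ((dsin s).mul (dIs s)))
    refine this.congr_deriv ?_
    have hsc := sin_sq_add_cos_sq (k * s)
    have e : k * (h / k) = h := by field_simp
    have e2 : k ^ 2 * k⁻¹ = k := by field_simp
    simp only [hv]
    linear_combination g s * hsc + k * sin (k * s) * e
      + (sin (k * s) * Ic s - cos (k * s) * Is s) * e2
  · intro s hs
    simp only [hg, IccExtend_of_mem hT.le _ hs, vw s hs]
    ring
  · simp [hv, hIs]
  · have h0 : Ic 0 = 0 := intervalIntegral.integral_same
    simp only [mul_zero, sin_zero, cos_zero, h0]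
    ring
  · have hTm : T ∈ Icc 0 T := ⟨hT.le, le_rfl⟩
    have h1 := hF
    rw [robinDefect, ← hw, ic T hTm, is T hTm, vw T hTm] at h1
    linarith

/-! ### Differentiation of integrals in a parameter -/

section ParametricIntegral

open Filter Topology

variable {c : ℝ} {f f' : ℝ → ℝ → ℝ}

/-- Joint continuity of a parametric integral with variable upper limit, for an integrand that is
continuous only for parameters `> c`. -/
theorem continuousAt_integral_of_continuousOn
    (hf : ContinuousOn (Function.uncurry f) (Ioi c ×ˢ univ)) {a : ℝ} (ha : c < a) (s : ℝ) :
    ContinuousAt (fun p : ℝ × ℝ => ∫ t in (0 : ℝ)..p.2, f p.1 t) (a, s) := by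
  obtain ⟨d, hcd, hda⟩ := exists_between ha
  -- Clamping the parameter at `d` makes the integrand continuous everywhere.
  have h1 : Continuous (Function.uncurry fun x t => f (max x d) t) := by
    have : Continuous fun p : ℝ × ℝ => Function.uncurry f (max p.1 d, p.2) :=
      hf.comp_continuous (by fun_prop) fun p => ⟨lt_max_of_lt_right hcd, mem_univ _⟩
    exact this
  have h2 : Continuous fun p : ℝ × ℝ => ∫ t in (0 : ℝ)..p.2, f (max p.1 d) t :=
    intervalIntegral.continuous_parametric_primitive_of_continuous h1
  refine h2.continuousAt.congr ?_
  filter_upwards [continuousAt_fst.eventually (lt_mem_nhds hda)] with p hp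
  rw [max_eq_left (le_of_lt hp)]

theorem hasDerivAt_integral_of_continuousOn
    (hf : ContinuousOn (Function.uncurry f) (Ioi c ×ˢ univ))
    (hf' : ContinuousOn (Function.uncurry f') (Ioi c ×ˢ univ))
    (hd : ∀ x, c < x → ∀ t, HasDerivAt (fun x => f x t) (f' x t) x) {a : ℝ} (ha : c < a) (s : ℝ) :
    HasDerivAt (fun x => ∫ t in (0 : ℝ)..s, f x t) (∫ t in (0 : ℝ)..s, f' a t) a := by
  obtain ⟨d, hcd, hda⟩ := exists_between ha
  have slice : ∀ {g : ℝ → ℝ → ℝ}, ContinuousOn (Function.uncurry g) (Ioi c ×ˢ univ) →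
      ∀ x, c < x → Continuous (g x) := fun {g} hg x hx =>
    hg.comp_continuous (f := fun t => (x, t)) (by fun_prop) fun t => ⟨hx, mem_univ _⟩
  have hK : IsCompact (Icc d (a + 1) ×ˢ uIcc 0 s) := isCompact_Icc.prod isCompact_uIcc
  obtain ⟨M, hM⟩ := hK.exists_bound_of_continuousOn
    (hf'.mono fun p hp => ⟨hcd.trans_le hp.1.1, mem_univ _⟩)
  refine (intervalIntegral.hasDerivAt_integral_of_dominated_loc_of_deriv_le
    (s := Icc d (a + 1)) (bound := fun _ => M) (Icc_mem_nhds hda (by linarith)) ?_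
    ((slice hf a ha).intervalIntegrable _ _) (slice hf' a ha).aestronglyMeasurable
    (.of_forall fun t ht x hx => hM (x, t) ⟨hx, uIoc_subset_uIcc ht⟩)
    intervalIntegrable_const
    (.of_forall fun t _ x hx => hd x (hcd.trans_le hx.1) t)).2
  filter_upwards [lt_mem_nhds ha] with x hx
  exact (slice hf x hx).aestronglyMeasurable

end ParametricIntegral

/-! ### Dependence of the profile functions on the parameters -/

theorem K_pos {a : ℝ} (ha : 1 / 2 < a) : 0 < K a := sqrt_pos.2 (by nlinarith)

theorem hasDerivAt_K {a : ℝ} (ha : 1 / 2 < a) : HasDerivAt K (a / K a) a := by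
  have h : HasDerivAt (fun x : ℝ => x ^ 2 - 1 / 4) (2 * a) a := by
    simpa using (hasDerivAt_pow 2 a).sub_const (1 / 4)
  have h1 : HasDerivAt K (2 * a / (2 * K a)) a := h.sqrt (by nlinarith)
  have := K_pos ha
  refine h1.congr_deriv ?_
  field_simp

theorem hasDerivAt_A_param {a : ℝ} (ha : 1 / 2 < a) (s : ℝ) :
    HasDerivAt (fun x => A x s) (cosh (2 * s) / (2 * A a s)) a := by
  have h : HasDerivAt (fun x : ℝ => x * cosh (2 * s) + 1 / 2) (cosh (2 * s)) a := by
    simpa using ((hasDerivAt_id a).mul_const (cosh (2 * s))).add_const (1 / 2)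
  exact h.sqrt (A_arg_pos ha s).ne'

theorem hasDerivAt_B_param {a : ℝ} (ha : 1 / 2 < a) (s : ℝ) :
    HasDerivAt (fun x => B x s) (cosh (2 * s) / (2 * B a s)) a := by
  have h : HasDerivAt (fun x : ℝ => x * cosh (2 * s) - 1 / 2) (cosh (2 * s)) a := by
    simpa using ((hasDerivAt_id a).mul_const (cosh (2 * s))).sub_const (1 / 2)
  exact h.sqrt (B_arg_pos ha s).ne'

theorem A_sq_eq {a : ℝ} (ha : 1 / 2 < a) (s : ℝ) : A a s ^ 2 = B a s ^ 2 + 1 := by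
  linarith [A_sq ha s, B_sq ha s]

theorem cosh_eq {a : ℝ} (ha : 1 / 2 < a) (s : ℝ) : a * cosh (2 * s) = B a s ^ 2 + 1 / 2 := by
  linarith [B_sq ha s]

/-- The first integral of the profile equation. -/
theorem sinh_sq_eq {a : ℝ} (ha : 1 / 2 < a) (s : ℝ) :
    (a * sinh (2 * s)) ^ 2 = B a s ^ 4 + B a s ^ 2 - K a ^ 2 := by
  have h1 := cosh_eq ha s
  have h2 := cosh_sq (2 * s)
  have h3 := K_sq ha
  linear_combination (a * cosh (2 * s) + B a s ^ 2 + 1 / 2) * h1 - a ^ 2 * h2 + h3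

/-- The `s`-derivative of the angle. -/
def angRate (a s : ℝ) : ℝ := K a / (A a s ^ 2 * B a s)

/-- The `a`-derivative of `angRate`. -/
def angRateParam (a s : ℝ) : ℝ :=
  a / (K a * (A a s ^ 2 * B a s))
    - K a * cosh (2 * s) * (1 / (A a s ^ 4 * B a s) + 1 / (2 * A a s ^ 2 * B a s ^ 3))

theorem hasDerivAt_angRate_param {a : ℝ} (ha : 1 / 2 < a) (s : ℝ) :
    HasDerivAt (fun x => angRate x s) (angRateParam a s) a := by
  have hA := A_pos ha s
  have hB := B_pos ha s
  have hK := K_pos ha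
  have := (hasDerivAt_K ha).div (((hasDerivAt_A_param ha s).pow 2).mul (hasDerivAt_B_param ha s))
    (mul_pos (pow_pos hA 2) hB).ne'
  refine this.congr_deriv ?_
  simp only [angRateParam, Pi.mul_apply, Pi.pow_apply]
  field_simp
  ring

theorem continuous_A_uncurry : Continuous fun p : ℝ × ℝ => A p.1 p.2 := by unfold A; fun_prop

theorem continuous_B_uncurry : Continuous fun p : ℝ × ℝ => B p.1 p.2 := by unfold B; fun_prop

theorem continuous_K : Continuous K := by unfold K; fun_prop

theorem continuousOn_angRate : ContinuousOn (Function.uncurry angRate) (Ioi (1 / 2) ×ˢ univ) := by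
  have h1 := continuous_A_uncurry.continuousOn (s := Ioi (1 / 2) ×ˢ univ)
  have h2 := continuous_B_uncurry.continuousOn (s := Ioi (1 / 2) ×ˢ univ)
  have h3 := (continuous_K.comp continuous_fst).continuousOn
    (s := Ioi (1 / 2 : ℝ) ×ˢ (univ : Set ℝ))
  refine h3.div ((h1.pow 2).mul h2) fun p hp => ?_
  have := A_pos hp.1 p.2
  have := B_pos hp.1 p.2
  positivity

theorem continuousOn_angRateParam :
    ContinuousOn (Function.uncurry angRateParam) (Ioi (1 / 2) ×ˢ univ) := by
  have h1 := continuous_A_uncurry.continuousOn (s := Ioi (1 / 2) ×ˢ univ)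
  have h2 := continuous_B_uncurry.continuousOn (s := Ioi (1 / 2) ×ˢ univ)
  have h3 := (continuous_K.comp continuous_fst).continuousOn
    (s := Ioi (1 / 2 : ℝ) ×ˢ (univ : Set ℝ))
  refine (continuousOn_fst.div (h3.mul ((h1.pow 2).mul h2)) fun p hp => ?_).sub
    ((h3.mul (by fun_prop : Continuous fun p : ℝ × ℝ => cosh (2 * p.2)).continuousOn).mul
      ((continuousOn_const.div ((h1.pow 4).mul h2) fun p hp => ?_).add
        (continuousOn_const.div ((continuousOn_const.mul (h1.pow 2)).mul (h2.pow 3))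
          fun p hp => ?_)))
  · exact (mul_pos (K_pos hp.1) (mul_pos (pow_pos (A_pos hp.1 p.2) 2) (B_pos hp.1 p.2))).ne'
  · exact (mul_pos (pow_pos (A_pos hp.1 p.2) 4) (B_pos hp.1 p.2)).ne'
  · exact (mul_pos (mul_pos two_pos (pow_pos (A_pos hp.1 p.2) 2))
      (pow_pos (B_pos hp.1 p.2) 3)).ne'

/-- The `a`-derivative of the angle. -/
def angParam (a s : ℝ) : ℝ := ∫ t in (0 : ℝ)..s, angRateParam a t

theorem hasDerivAt_ang_param {a : ℝ} (ha : 1 / 2 < a) (s : ℝ) :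
    HasDerivAt (fun x => ang x s) (angParam a s) a :=
  hasDerivAt_integral_of_continuousOn continuousOn_angRate continuousOn_angRateParam
    (fun _ hx t => hasDerivAt_angRate_param hx t) ha s

theorem continuousAt_angParam {a : ℝ} (ha : 1 / 2 < a) (s : ℝ) :
    ContinuousAt (fun p : ℝ × ℝ => angParam p.1 p.2) (a, s) :=
  continuousAt_integral_of_continuousOn continuousOn_angRateParam ha s

theorem continuousAt_ang {a : ℝ} (ha : 1 / 2 < a) (s : ℝ) :
    ContinuousAt (fun p : ℝ × ℝ => ang p.1 p.2) (a, s) :=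
  continuousAt_integral_of_continuousOn continuousOn_angRate ha s

theorem continuous_angRateParam {a : ℝ} (ha : 1 / 2 < a) : Continuous (angRateParam a) :=
  continuousOn_angRateParam.comp_continuous (f := fun t => (a, t)) (by fun_prop)
    fun _ => ⟨ha, mem_univ _⟩

theorem hasDerivAt_angParam {a : ℝ} (ha : 1 / 2 < a) (s : ℝ) :
    HasDerivAt (angParam a) (angRateParam a s) s :=
  ((continuous_angRateParam ha).integral_hasStrictDerivAt 0 s).hasDerivAt

theorem A_neg (a s : ℝ) : A a (-s) = A a s := by simp [A]

theorem B_neg (a s : ℝ) : B a (-s) = B a s := by simp [B]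

theorem angParam_neg (a s : ℝ) : angParam a (-s) = -angParam a s := by
  have h : ∀ t, angRateParam a (-t) = angRateParam a t := fun t => by
    simp [angRateParam, A_neg, B_neg]
  have := intervalIntegral.integral_comp_neg (a := 0) (b := s) (angRateParam a)
  simp only [h, neg_zero] at this
  rw [angParam, angParam, this, intervalIntegral.integral_symm]

/-! ### The Jacobi function of the family -/

theorem hasDerivAt_X_param {a : ℝ} (ha : 1 / 2 < a) (s θ : ℝ) :
    HasDerivAt (fun b => X b s θ)
      ![cosh (2 * s) / (2 * A a s) * cosh (ang a s)
          + A a s * (sinh (ang a s) * angParam a s),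
        cosh (2 * s) / (2 * A a s) * sinh (ang a s)
          + A a s * (cosh (ang a s) * angParam a s),
        cosh (2 * s) / (2 * B a s) * cos θ,
        cosh (2 * s) / (2 * B a s) * sin θ] a := by
  rw [hasDerivAt_pi]
  intro i
  have h1 := hasDerivAt_A_param ha s
  have h2 := hasDerivAt_B_param ha s
  have h3 := hasDerivAt_ang_param ha s
  fin_cases i
  · exact h1.mul h3.cosh
  · exact h1.mul h3.sinh
  · exact h2.mul_const _
  · exact h2.mul_const _

/-- Closed form of `paramJacobi` in terms of the `a`-derivative of the angle. -/
def jac (a s : ℝ) : ℝ :=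
  K a * cosh (2 * s) / (2 * (A a s ^ 2 * B a s ^ 2)) - a * sinh (2 * s) / B a s * angParam a s

theorem paramJacobi_eq {a : ℝ} (ha : 1 / 2 < a) (s θ : ℝ) : paramJacobi a s θ = jac a s := by
  have hA := A_pos ha s
  have hB := B_pos ha s
  have h4 := cosh_sq (ang a s)
  have h6 := sin_sq_add_cos_sq θ
  have h7 := A_sq_eq ha s
  rw [paramJacobi, (hasDerivAt_X_param ha s θ).deriv]
  simp only [lorentz, normal, jac, Matrix.cons_val]
  have e : K a * cosh (2 * s) / (2 * (A a s ^ 2 * B a s ^ 2))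
      = K a * cosh (2 * s) / (2 * B a s ^ 2) - K a * cosh (2 * s) / (2 * A a s ^ 2) := by
    field_simp
    linear_combination -K a * h7
  have e2 : A a s * (a * sinh (2 * s) / (A a s * B a s)) = a * sinh (2 * s) / B a s := by
    field_simp
  rw [e]
  linear_combination K a * cosh (2 * s) / (2 * B a s ^ 2) * h6
    - K a * cosh (2 * s) / (2 * A a s ^ 2) * h4
    - a * sinh (2 * s) / (A a s * B a s) * A a s * angParam a s * h4 - angParam a s * e2

theorem jac_neg (a s : ℝ) : jac a (-s) = jac a s := by
  simp [jac, A_neg, B_neg, angParam_neg]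
  ring

/-! ### Implicit differentiation in two real variables -/

section Implicit

open Filter Topology ContinuousLinearMap

variable {f f₁ f₂ : ℝ → ℝ → ℝ} {a s : ℝ}

theorem hasStrictFDerivAt_of_partials
    (d₁ : ∀ᶠ v : ℝ × ℝ in 𝓝 (a, s), HasDerivAt (f · v.2) (f₁ v.1 v.2) v.1)
    (d₂ : ∀ᶠ v : ℝ × ℝ in 𝓝 (a, s), HasDerivAt (f v.1 ·) (f₂ v.1 v.2) v.2)
    (c₁ : ContinuousAt (fun v : ℝ × ℝ => f₁ v.1 v.2) (a, s))
    (c₂ : ContinuousAt (fun v : ℝ × ℝ => f₂ v.1 v.2) (a, s)) :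
    HasStrictFDerivAt (fun v : ℝ × ℝ => f v.1 v.2)
      ((toSpanSingleton ℝ (f₁ a s)).coprod (toSpanSingleton ℝ (f₂ a s))) (a, s) :=
  hasStrictFDerivAt_uncurry_coprod (u := (a, s)) (f := f)
    (f₁ := fun x y => toSpanSingleton ℝ (f₁ x y)) (f₂ := fun x y => toSpanSingleton ℝ (f₂ x y))
    (d₁.mono fun _ h => h.hasFDerivAt) (d₂.mono fun _ h => h.hasFDerivAt)
    ((toSpanSingletonCLE (𝕜 := ℝ) (E := ℝ)).continuous.continuousAt.comp c₁)
    ((toSpanSingletonCLE (𝕜 := ℝ) (E := ℝ)).continuous.continuousAt.comp c₂)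

/-- A function `σ` that near `(a, s)` collects all zeros of `f` is differentiable, with the
derivative given by the implicit function theorem. -/
theorem hasDerivAt_of_eventually_unique_zero {σ : ℝ → ℝ}
    (d₁ : ∀ᶠ v : ℝ × ℝ in 𝓝 (a, s), HasDerivAt (f · v.2) (f₁ v.1 v.2) v.1)
    (d₂ : ∀ᶠ v : ℝ × ℝ in 𝓝 (a, s), HasDerivAt (f v.1 ·) (f₂ v.1 v.2) v.2)
    (c₁ : ContinuousAt (fun v : ℝ × ℝ => f₁ v.1 v.2) (a, s))
    (c₂ : ContinuousAt (fun v : ℝ × ℝ => f₂ v.1 v.2) (a, s))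
    (h0 : f a s = 0) (h2 : f₂ a s ≠ 0)
    (hσ : ∀ᶠ v : ℝ × ℝ in 𝓝 (a, s), f v.1 v.2 = 0 → v.2 = σ v.1) :
    HasDerivAt σ (-f₁ a s / f₂ a s) a := by
  have hinv : (toSpanSingleton ℝ (f₂ a s)).IsInvertible := by
    refine ⟨ContinuousLinearEquiv.unitsEquivAut ℝ (Units.mk0 _ h2), ?_⟩
    ext
    simp
  have hd₁ := d₁.mono fun _ h => h.hasFDerivAt
  have hd₂ := d₂.mono fun _ h => h.hasFDerivAt
  have hc₁ := (toSpanSingletonCLE (𝕜 := ℝ) (E := ℝ)).continuous.continuousAt.comp c₁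
  have hc₂ := (toSpanSingletonCLE (𝕜 := ℝ) (E := ℝ)).continuous.continuousAt.comp c₂
  have key := hasStrictFDerivAt_implicitFunctionOfBivariate (u := (a, s)) (f := f)
    (f₁ := fun x y => toSpanSingleton ℝ (f₁ x y)) (f₂ := fun x y => toSpanSingleton ℝ (f₂ x y))
    hd₁ hd₂ hc₁ hc₂ hinv
  have kt := tendsto_implicitFunctionOfBivariate (u := (a, s)) (f := f)
    (f₁ := fun x y => toSpanSingleton ℝ (f₁ x y)) (f₂ := fun x y => toSpanSingleton ℝ (f₂ x y))
    hd₁ hd₂ hc₁ hc₂ hinv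
  have kz := eventually_apply_implicitFunctionOfBivariate (u := (a, s)) (f := f)
    (f₁ := fun x y => toSpanSingleton ℝ (f₁ x y)) (f₂ := fun x y => toSpanSingleton ℝ (f₂ x y))
    hd₁ hd₂ hc₁ hc₂ hinv
  set ψ := implicitFunctionOfBivariate (u := (a, s)) (f := f)
    (f₁ := fun x y => toSpanSingleton ℝ (f₁ x y)) (f₂ := fun x y => toSpanSingleton ℝ (f₂ x y))
    hd₁ hd₂ hc₁ hc₂ hinv
  have hpair : Tendsto (fun x => (x, ψ x)) (𝓝 a) (𝓝 (a, s)) := tendsto_id.prodMk_nhds kt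
  have heq : ∀ᶠ x in 𝓝 a, σ x = ψ x := by
    filter_upwards [hpair.eventually hσ, kz] with x hx hz
    exact (hx (hz.trans h0)).symm
  have hψ : HasDerivAt ψ (-f₁ a s / f₂ a s) a := by
    have := key.hasFDerivAt.hasDerivAt
    refine this.congr_deriv ?_
    have hi : (toSpanSingleton ℝ (f₂ a s)).inverse = toSpanSingleton ℝ (f₂ a s)⁻¹ := by
      have : toSpanSingleton ℝ (f₂ a s)
          = (ContinuousLinearEquiv.unitsEquivAut ℝ (Units.mk0 _ h2) : ℝ →L[ℝ] ℝ) := by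
        ext
        simp
      rw [this, ContinuousLinearMap.inverse_equiv]
      ext
      simp [ContinuousLinearEquiv.unitsEquivAut]
    simp [hi, div_eq_mul_inv]
  exact hψ.congr_of_eventuallyEq heq

end Implicit

/-! ### The free boundary condition -/

theorem hasDerivAt_tanh (x : ℝ) : HasDerivAt tanh (1 - tanh x ^ 2) x := by
  have h := (hasDerivAt_sinh x).div (hasDerivAt_cosh x) (cosh_pos x).ne'
  have e : (sinh / cosh : ℝ → ℝ) = tanh := by
    ext y
    exact (tanh_eq_sinh_div_cosh y).symm
  rw [e] at h
  refine h.congr_deriv ?_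
  rw [tanh_eq_sinh_div_cosh]
  have := cosh_pos x
  field_simp

theorem continuous_tanh : Continuous tanh :=
  continuous_iff_continuousAt.2 fun x => (hasDerivAt_tanh x).continuousAt

theorem strictMono_tanh : StrictMono tanh := by
  refine strictMono_of_hasDerivAt_pos hasDerivAt_tanh fun x => ?_
  linarith [tanh_sq_lt_one x]

/-- The derivative `B'` of the warping function, an odd Jacobi function of mode `0` that comes from
the translations along the axis. -/
def slope (a s : ℝ) : ℝ := a * sinh (2 * s) / B a s

theorem hasDerivAt_slope {a : ℝ} (ha : 1 / 2 < a) (s : ℝ) :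
    HasDerivAt (slope a) (B a s + K a ^ 2 / B a s ^ 3) s := by
  have hB := B_pos ha s
  have h2 : HasDerivAt (fun t : ℝ => 2 * t) 2 s := by
    simpa using (hasDerivAt_id s).const_mul 2
  have h := (h2.sinh.const_mul a).div (hasDerivAt_B ha s) hB.ne'
  refine h.congr_deriv ?_
  have h3 := sinh_sq_eq ha s
  have h4 := cosh_eq ha s
  field_simp
  linear_combination 2 * B a s ^ 2 * h4 - h3

theorem slope_sq {a : ℝ} (ha : 1 / 2 < a) (s : ℝ) :
    slope a s ^ 2 = B a s ^ 2 + 1 - K a ^ 2 / B a s ^ 2 := by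
  have hB := B_pos ha s
  have h3 := sinh_sq_eq ha s
  rw [slope, div_pow, h3]
  field_simp

theorem slope_pos {a : ℝ} (ha : 1 / 2 < a) {s : ℝ} (hs : 0 < s) : 0 < slope a s :=
  div_pos (mul_pos (by linarith) (sinh_pos_iff.2 (by linarith))) (B_pos ha s)

theorem strictMono_slope {a : ℝ} (ha : 1 / 2 < a) : StrictMono (slope a) := by
  refine strictMono_of_hasDerivAt_pos (hasDerivAt_slope ha) fun s => ?_
  have := B_pos ha s
  have := K_pos ha
  positivity

theorem hasDerivAt_ang' {a : ℝ} (ha : 1 / 2 < a) (s : ℝ) :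
    HasDerivAt (ang a) (angRate a s) s := hasDerivAt_ang ha s

theorem angRate_pos {a : ℝ} (ha : 1 / 2 < a) (s : ℝ) : 0 < angRate a s := by
  have := A_pos ha s
  have := B_pos ha s
  have := K_pos ha
  unfold angRate
  positivity

theorem strictMono_ang {a : ℝ} (ha : 1 / 2 < a) : StrictMono (ang a) :=
  strictMono_of_hasDerivAt_pos (hasDerivAt_ang' ha) (angRate_pos ha)

theorem ang_zero (a : ℝ) : ang a 0 = 0 := intervalIntegral.integral_same

theorem ang_pos {a : ℝ} (ha : 1 / 2 < a) {s : ℝ} (hs : 0 < s) : 0 < ang a s := by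
  simpa [ang_zero] using strictMono_ang ha hs

theorem tanh_ang_pos {a : ℝ} (ha : 1 / 2 < a) {s : ℝ} (hs : 0 < s) : 0 < tanh (ang a s) := by
  simpa using strictMono_tanh (ang_pos ha hs)

/-- The free boundary condition says `B' tanh (ang) = K`; this is the difference of the two
sides. -/
def defect (a s : ℝ) : ℝ := slope a s * tanh (ang a s) - K a

theorem freeBoundary_iff {a : ℝ} (ha : 1 / 2 < a) {s : ℝ} (hs : 0 < s) :
    FreeBoundary a s ↔ defect a s = 0 := by
  have hB := B_pos ha s
  have hS : 0 < a * sinh (2 * s) := mul_pos (by linarith) (sinh_pos_iff.2 (by linarith))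
  rw [FreeBoundary, defect, slope, eq_div_iff hS.ne', sub_eq_zero, div_mul_eq_mul_div,
    div_eq_iff hB.ne']
  constructor <;> intro h <;> linarith

theorem strictMonoOn_defect {a : ℝ} (ha : 1 / 2 < a) : StrictMonoOn (defect a) (Ioi 0) := by
  intro s hs t ht hst
  have h1 := strictMono_slope ha hst
  have h2 := strictMono_tanh (strictMono_ang ha hst)
  have h3 := slope_pos ha hs
  have h4 := tanh_ang_pos ha hs
  have := mul_lt_mul'' h1 h2 h3.le h4.le
  unfold defect
  linarith

theorem B_zero_le {a : ℝ} (ha : 1 / 2 < a) (s : ℝ) : B a 0 ≤ B a s := by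
  unfold B
  apply sqrt_le_sqrt
  have := one_le_cosh (2 * s)
  simp only [mul_zero, cosh_zero]
  nlinarith

theorem mul_le_slope {a : ℝ} (ha : 1 / 2 < a) {s : ℝ} (hs : 0 ≤ s) : B a 0 * s ≤ slope a s := by
  have hm : Monotone fun s => slope a s - B a 0 * s := by
    refine monotone_of_hasDerivAt_nonneg (f' := fun s => B a s + K a ^ 2 / B a s ^ 3 - B a 0)
      (fun s => ?_) fun s => ?_
    · exact ((hasDerivAt_slope ha s).sub ((hasDerivAt_id s).const_mul (B a 0))).congr_deriv
        (by simp)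
    · have := B_zero_le ha s
      have := B_pos ha s
      have : 0 ≤ K a ^ 2 / B a s ^ 3 := by positivity
      simp only [Pi.zero_apply]
      linarith
  simpa [slope] using hm hs

theorem continuous_defect {a : ℝ} (ha : 1 / 2 < a) : Continuous (defect a) := by
  have h1 : Continuous (slope a) :=
    continuous_iff_continuousAt.2 fun s => (hasDerivAt_slope ha s).continuousAt
  have h2 : Continuous (ang a) :=
    continuous_iff_continuousAt.2 fun s => (hasDerivAt_ang ha s).continuousAt
  exact (h1.mul (continuous_tanh.comp h2)).sub continuous_const

theorem exists_defect_eq_zero {a : ℝ} (ha : 1 / 2 < a) : ∃ s, 0 < s ∧ defect a s = 0 := by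
  have hK := K_pos ha
  have hB := B_pos ha 0
  have ht := tanh_ang_pos ha one_pos
  set s₁ := max 1 (K a / (B a 0 * tanh (ang a 1))) with hs₁
  have h1 : 1 ≤ s₁ := le_max_left _ _
  have h2 : K a / (B a 0 * tanh (ang a 1)) ≤ s₁ := le_max_right _ _
  have h3 : 0 ≤ defect a s₁ := by
    have e1 := mul_le_slope ha (zero_le_one.trans h1)
    have e2 : tanh (ang a 1) ≤ tanh (ang a s₁) :=
      strictMono_tanh.monotone ((strictMono_ang ha).monotone h1)
    rw [div_le_iff₀ (by positivity)] at h2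
    have e3 := mul_le_mul e1 e2 ht.le (le_trans (by positivity) e1)
    unfold defect
    linarith
  have h0 : defect a 0 < 0 := by
    simp [defect, slope, hK]
  obtain ⟨s, hs, hs0⟩ := intermediate_value_Icc (zero_le_one.trans h1)
    (continuous_defect ha).continuousOn ⟨h0.le, h3⟩
  refine ⟨s, lt_of_le_of_ne hs.1 ?_, hs0⟩
  rintro rfl
  exact h0.ne hs0

theorem eq_s₀ {a : ℝ} (ha : 1 / 2 < a) {s : ℝ} (hs : 0 < s) (h : defect a s = 0) : s = s₀ a := by
  have : {t : ℝ | 0 < t ∧ FreeBoundary a t} = {s} := by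
    ext t
    constructor
    · rintro ⟨ht, hf⟩
      exact (strictMonoOn_defect ha).injOn ht hs (((freeBoundary_iff ha ht).1 hf).trans h.symm)
    · rintro rfl
      exact ⟨hs, (freeBoundary_iff ha hs).2 h⟩
  rw [s₀, this, csInf_singleton]

theorem s₀_spec {a : ℝ} (ha : 1 / 2 < a) : 0 < s₀ a ∧ defect a (s₀ a) = 0 := by
  obtain ⟨s, hs, h⟩ := exists_defect_eq_zero ha
  rw [← eq_s₀ ha hs h]
  exact ⟨hs, h⟩

/-! ### The free boundary lies beyond `B² = 2 K²` -/

/-- The tangent line bound `log x ≤ x / 4 + log 4 - 1` at `x = 1 + 2 c ≥ c + √(1 + c²)`. -/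
theorem arsinh_le {c : ℝ} (hc : 0 ≤ c) : arsinh c ≤ c / 2 + 3 / 4 := by
  have h1 : √(1 + c ^ 2) ≤ 1 + c := by
    rw [sqrt_le_left (by linarith)]
    nlinarith
  have h2 : 0 < √(1 + c ^ 2) := sqrt_pos.2 (by positivity)
  have h3 : arsinh c ≤ log (4 * ((1 + 2 * c) / 4)) := by
    unfold arsinh
    exact log_le_log (by linarith) (by linarith)
  have h4 : log (4 : ℝ) = 2 * log 2 := by
    rw [show (4 : ℝ) = 2 ^ 2 by norm_num, log_pow]
    norm_num
  have h5 := log_le_sub_one_of_pos (show 0 < (1 + 2 * c) / 4 by positivity)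
  rw [log_mul (by norm_num) (by positivity), h4] at h3
  have h6 := log_two_lt_d9
  norm_num at h6 ⊢
  linarith

theorem sqrt_two_mul_arsinh_lt {c : ℝ} (hc : 0 < c) : √2 * c * arsinh c < c ^ 2 + 1 := by
  have h1 := arsinh_le hc.le
  have h2 : √2 < 1.4143 := by
    rw [sqrt_lt' (by norm_num)]
    norm_num
  have h0 : 0 < √2 := by positivity
  have h3 : √2 * c * arsinh c ≤ √2 * c * (c / 2 + 3 / 4) := by gcongr
  have h4 : √2 * (c * (c / 2 + 3 / 4)) < 1.4143 * (c * (c / 2 + 3 / 4)) := by gcongr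
  nlinarith [sq_nonneg (c - 1.81)]

/-- An explicit bound of the angle, from `A² ≥ a + 1 / 2`, `1 ≤ cosh s` and
`B² = a - 1 / 2 + 2 a sinh² s`. -/
theorem ang_le {a : ℝ} (ha : 1 / 2 < a) {s : ℝ} (hs : 0 ≤ s) :
    ang a s ≤ K a / ((a + 1 / 2) * √(2 * a)) * arsinh (√(2 * a) * sinh s / B a 0) := by
  have hB0 := B_pos ha 0
  have hc : 0 < √(2 * a) := sqrt_pos.2 (by linarith)
  have hc2 : √(2 * a) ^ 2 = 2 * a := sq_sqrt (by linarith)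
  have hB02 : B a 0 ^ 2 = a - 1 / 2 := by
    rw [B_sq ha]
    simp
  have hd : ∀ t, HasDerivAt
      (fun t => K a / ((a + 1 / 2) * √(2 * a)) * arsinh (√(2 * a) * sinh t / B a 0) - ang a t)
      (K a * cosh t / ((a + 1 / 2) * B a t) - angRate a t) t := fun t => by
    have hB := B_pos ha t
    have h1 := ((((hasDerivAt_sinh t).const_mul √(2 * a)).div_const (B a 0)).arsinh.const_mul
      (K a / ((a + 1 / 2) * √(2 * a)))).sub (hasDerivAt_ang' ha t)
    refine h1.congr_deriv ?_
    have h2 : √(1 + (√(2 * a) * sinh t / B a 0) ^ 2) = B a t / B a 0 := by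
      rw [sqrt_eq_iff_mul_self_eq (by positivity) (by positivity)]
      have h3 := cosh_two_mul t
      have h4 := cosh_sq t
      have h5 := B_sq ha t
      field_simp
      rw [hc2, h5, hB02, h3, h4]
      ring
    rw [h2, smul_eq_mul]
    have : a + 1 / 2 ≠ 0 := by linarith
    field_simp
  have hm := monotone_of_hasDerivAt_nonneg hd (fun t => by
    have hB := B_pos ha t
    have hA := A_pos ha t
    have hK := K_pos ha
    have h1 := one_le_cosh t
    have h2 : a + 1 / 2 ≤ A a t ^ 2 := by
      rw [A_sq ha]
      nlinarith [one_le_cosh (2 * t)]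
    have h3 : K a * 1 / (A a t ^ 2 * B a t) ≤ K a * cosh t / ((a + 1 / 2) * B a t) := by
      gcongr
    simp only [Pi.zero_apply, angRate]
    rw [mul_one] at h3
    linarith)
  have := hm hs
  simp only [sinh_zero, mul_zero, zero_div, arsinh_zero, ang_zero, sub_zero] at this
  linarith

theorem tanh_le_self {x : ℝ} (hx : 0 ≤ x) : tanh x ≤ x := by
  have hm : Monotone fun x => x - tanh x :=
    monotone_of_hasDerivAt_nonneg (fun x => (hasDerivAt_id x).sub (hasDerivAt_tanh x)) fun x => by
      simp only [Pi.zero_apply]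
      nlinarith [sq_nonneg (tanh x)]
  have := hm hx
  simp only [tanh_zero, sub_zero] at this
  linarith

/-- While `B² ≤ 2 K²`, the angle is too small for the free boundary condition. In geometric terms,
`B'' / B' < B' / B` at the boundary. -/
theorem two_mul_K_sq_lt {a : ℝ} (ha : 1 / 2 < a) : 2 * K a ^ 2 < B a (s₀ a) ^ 2 := by
  obtain ⟨hs, h0⟩ := s₀_spec ha
  by_contra! hle
  set s := s₀ a
  have hB := B_pos ha s
  have hB0 := B_pos ha 0
  have hK := K_pos ha
  have hK2 := K_sq ha
  have hc : 0 < √(2 * a) := sqrt_pos.2 (by linarith)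
  have hc2 : √(2 * a) ^ 2 = 2 * a := sq_sqrt (by linarith)
  have h2 : √2 ^ 2 = 2 := sq_sqrt (by norm_num)
  have hB02 : B a 0 ^ 2 = a - 1 / 2 := by
    rw [B_sq ha]
    simp
  have hsl := slope_pos ha hs
  have e1 : slope a s ≤ √2 * a := by
    refine le_of_sq_le_sq ?_ (by positivity)
    rw [slope_sq ha, mul_pow, h2]
    have : 1 / 2 ≤ K a ^ 2 / B a s ^ 2 := by
      rw [le_div_iff₀ (by positivity)]
      linarith
    linarith
  have e2 : √(2 * a) * sinh s / B a 0 ≤ √(2 * a) := by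
    rw [div_le_iff₀ hB0]
    have : sinh s ≤ B a 0 := by
      refine le_of_sq_le_sq ?_ hB0.le
      have h3 := cosh_two_mul s
      have h4 := cosh_sq s
      have h5 := B_sq ha s
      rw [hB02]
      nlinarith
    gcongr
  have e3 := (tanh_le_self (ang_pos ha hs).le).trans (ang_le ha hs.le)
  have e4 : K a / ((a + 1 / 2) * √(2 * a)) * arsinh (√(2 * a) * sinh s / B a 0)
      ≤ K a / ((a + 1 / 2) * √(2 * a)) * arsinh √(2 * a) := by
    have := arsinh_le_arsinh.2 e2
    gcongr
  have e5 : tanh (ang a s) < K a / (√2 * a) := by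
    refine (e3.trans e4).trans_lt ?_
    have := sqrt_two_mul_arsinh_lt hc
    rw [div_mul_eq_mul_div, div_lt_div_iff₀ (by positivity) (by positivity)]
    have e6 : √2 * √(2 * a) * arsinh √(2 * a) * (K a * √(2 * a))
        < (√(2 * a) ^ 2 + 1) * (K a * √(2 * a)) := by gcongr
    have e7 : √2 * √(2 * a) * arsinh √(2 * a) * (K a * √(2 * a))
        = 2 * (K a * arsinh √(2 * a) * (√2 * a)) := by
      linear_combination √2 * arsinh √(2 * a) * K a * hc2
    rw [e7, hc2] at e6
    linarith
  have e8 : slope a s * tanh (ang a s) < √2 * a * (K a / (√2 * a)) :=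
    mul_lt_mul' e1 e5 (tanh_ang_pos ha hs).le (by positivity)
  rw [mul_div_cancel₀ _ (by positivity : √2 * a ≠ 0)] at e8
  unfold defect at h0
  linarith

/-! ### The derivative of the radius -/

section RadiusAlgebra

variable {A B K a Y C Φ : ℝ}

/-- `∂ₛ defect` at a free boundary, where `tanh (ang) = K B / Y` with `Y = a sinh (2 s)`. -/
theorem defect_deriv_algebra (hB : 0 < B) (hY : 0 < Y)
    (hA2 : A ^ 2 = B ^ 2 + 1) (hY2 : Y ^ 2 = B ^ 4 + B ^ 2 - K ^ 2) :
    (B + K ^ 2 / B ^ 3) * (K * B / Y)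
      + Y / B * ((1 - (K * B / Y) ^ 2) * (K / (A ^ 2 * B))) = A ^ 2 * K / Y := by
  have hB1 : B ^ 2 + 1 ≠ 0 := by positivity
  rw [hA2]
  field_simp
  rw [hY2]
  ring

/-- `∂ₛ height / cosh (ang)` at a free boundary. -/
theorem height_deriv_algebra (hA : 0 < A) (hB : 0 < B) (hY : 0 < Y)
    (hA2 : A ^ 2 = B ^ 2 + 1) (hY2 : Y ^ 2 = B ^ 4 + B ^ 2 - K ^ 2) :
    Y / A + A * (K * B / Y * (K / (A ^ 2 * B))) = A * B ^ 2 / Y := by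
  field_simp
  rw [hY2, hA2]
  ring

/-- The Jacobian determinant of `(height, defect)`, divided by `cosh (ang)`, at a free boundary: its
coefficient of `Φ` is a multiple of `B² - 2 K²` and combines with the rest to the Jacobi
function. -/
theorem radius_deriv_algebra (hA : 0 < A) (hB : 0 < B) (hY : 0 < Y) (hK : 0 < K) (ha : 0 < a)
    (hA2 : A ^ 2 = B ^ 2 + 1) (hY2 : Y ^ 2 = B ^ 4 + B ^ 2 - K ^ 2) (hC : a * C = B ^ 2 + 1 / 2)
    (hK2 : K ^ 2 = a ^ 2 - 1 / 4) :
    (C / (2 * A) + A * (K * B / Y * Φ)) * (A ^ 2 * K / Y)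
      - A * B ^ 2 / Y * ((Y / a / B - Y * (C / (2 * B)) / B ^ 2) * (K * B / Y)
          + Y / B * ((1 - (K * B / Y) ^ 2) * Φ) - a / K)
      = A * B ^ 2 * (B ^ 2 + 1) / Y ^ 3
        * ((B ^ 2 - 2 * K ^ 2) * (K * C / (2 * (A ^ 2 * B ^ 2)) - Y / B * Φ) + a * B ^ 2 / K) := by
  have hC' : C = (B ^ 2 + 1 / 2) / a := by
    rw [eq_div_iff ha.ne']
    linarith
  have hA3 : A ^ 3 = A * (B ^ 2 + 1) := by rw [← hA2]; ring
  have hA4 : A ^ 4 = (B ^ 2 + 1) ^ 2 := by rw [← hA2]; ring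
  have hY4 : Y ^ 4 = (B ^ 4 + B ^ 2 - K ^ 2) ^ 2 := by rw [← hY2]; ring
  have hK4 : K ^ 4 = (a ^ 2 - 1 / 4) ^ 2 := by rw [← hK2]; ring
  subst hC'
  field_simp
  ring_nf
  grind

end RadiusAlgebra

section Partials

open Filter Topology

variable {a : ℝ}

/-- The `s`-derivative of `defect`. -/
def defectS (a s : ℝ) : ℝ :=
  (B a s + K a ^ 2 / B a s ^ 3) * tanh (ang a s)
    + slope a s * ((1 - tanh (ang a s) ^ 2) * angRate a s)

/-- The `a`-derivative of `defect`. -/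
def defectParam (a s : ℝ) : ℝ :=
  (sinh (2 * s) / B a s - a * sinh (2 * s) * (cosh (2 * s) / (2 * B a s)) / B a s ^ 2)
      * tanh (ang a s)
    + slope a s * ((1 - tanh (ang a s) ^ 2) * angParam a s) - a / K a

/-- The hyperbolic cosine of the distance of `X a s θ` to the pole. -/
def height (a s : ℝ) : ℝ := A a s * cosh (ang a s)

/-- The `s`-derivative of `height`. -/
def heightS (a s : ℝ) : ℝ :=
  a * sinh (2 * s) / A a s * cosh (ang a s) + A a s * (sinh (ang a s) * angRate a s)

/-- The `a`-derivative of `height`. -/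
def heightParam (a s : ℝ) : ℝ :=
  cosh (2 * s) / (2 * A a s) * cosh (ang a s) + A a s * (sinh (ang a s) * angParam a s)

theorem hasDerivAt_defect (ha : 1 / 2 < a) (s : ℝ) : HasDerivAt (defect a) (defectS a s) s :=
  ((hasDerivAt_slope ha s).mul ((hasDerivAt_tanh _).comp s (hasDerivAt_ang' ha s))).sub_const _

theorem hasDerivAt_defect_param (ha : 1 / 2 < a) (s : ℝ) :
    HasDerivAt (fun x => defect x s) (defectParam a s) a := by
  have hB := B_pos ha s
  have h1 := ((hasDerivAt_id a).mul_const (sinh (2 * s))).div (hasDerivAt_B_param ha s) hB.ne'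
  have h2 := (h1.mul ((hasDerivAt_tanh _).comp a (hasDerivAt_ang_param ha s))).sub
    (hasDerivAt_K ha)
  refine h2.congr_deriv ?_
  simp only [defectParam, slope, id, Function.comp_apply, Pi.div_apply]
  field_simp

theorem hasDerivAt_height (ha : 1 / 2 < a) (s : ℝ) : HasDerivAt (height a) (heightS a s) s :=
  (hasDerivAt_A ha s).mul (hasDerivAt_ang' ha s).cosh

theorem hasDerivAt_height_param (ha : 1 / 2 < a) (s : ℝ) :
    HasDerivAt (fun x => height x s) (heightParam a s) a :=
  (hasDerivAt_A_param ha s).mul (hasDerivAt_ang_param ha s).cosh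

theorem continuousAt_partials (ha : 1 / 2 < a) (s : ℝ) :
    ContinuousAt (fun v : ℝ × ℝ => defectParam v.1 v.2) (a, s) ∧
    ContinuousAt (fun v : ℝ × ℝ => defectS v.1 v.2) (a, s) ∧
    ContinuousAt (fun v : ℝ × ℝ => heightParam v.1 v.2) (a, s) ∧
    ContinuousAt (fun v : ℝ × ℝ => heightS v.1 v.2) (a, s) := by
  have cA := continuous_A_uncurry.continuousAt (x := (a, s))
  have cB := continuous_B_uncurry.continuousAt (x := (a, s))
  have cK : ContinuousAt (fun v : ℝ × ℝ => K v.1) (a, s) :=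
    (continuous_K.comp continuous_fst).continuousAt
  have cang := continuousAt_ang ha s
  have cangP := continuousAt_angParam ha s
  have cch : ContinuousAt (fun v : ℝ × ℝ => cosh (ang v.1 v.2)) (a, s) :=
    continuous_cosh.continuousAt.comp cang
  have csh : ContinuousAt (fun v : ℝ × ℝ => sinh (ang v.1 v.2)) (a, s) :=
    continuous_sinh.continuousAt.comp cang
  have cth : ContinuousAt (fun v : ℝ × ℝ => tanh (ang v.1 v.2)) (a, s) :=
    continuous_tanh.continuousAt.comp cang
  have cC : ContinuousAt (fun v : ℝ × ℝ => cosh (2 * v.2)) (a, s) := by fun_prop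
  have cS : ContinuousAt (fun v : ℝ × ℝ => sinh (2 * v.2)) (a, s) := by fun_prop
  have cf : ContinuousAt (fun v : ℝ × ℝ => v.1) (a, s) := continuousAt_fst
  have hA := A_pos ha s
  have hB := B_pos ha s
  have hK := K_pos ha
  have crate : ContinuousAt (fun v : ℝ × ℝ => angRate v.1 v.2) (a, s) :=
    cK.div ((cA.pow 2).mul cB) (mul_pos (pow_pos hA 2) hB).ne'
  have csl : ContinuousAt (fun v : ℝ × ℝ => slope v.1 v.2) (a, s) :=
    (cf.mul cS).div cB hB.ne'
  have c1 : ContinuousAt (fun v : ℝ × ℝ => 1 - tanh (ang v.1 v.2) ^ 2) (a, s) :=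
    continuousAt_const.sub (cth.pow 2)
  refine ⟨?_, ?_, ?_, ?_⟩
  · exact ((((cS.div cB hB.ne').sub (((cf.mul cS).mul (cC.div (continuousAt_const.mul cB)
      (mul_pos two_pos hB).ne')).div (cB.pow 2) (pow_pos hB 2).ne')).mul cth).add
        (csl.mul (c1.mul cangP))).sub (cf.div cK hK.ne')
  · exact ((cB.add ((cK.pow 2).div (cB.pow 3) (pow_pos hB 3).ne')).mul cth).add
      (csl.mul (c1.mul crate))
  · exact ((cC.div (continuousAt_const.mul cA) (mul_pos two_pos hA).ne').mul cch).add
      (cA.mul (csh.mul cangP))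
  · exact (((cf.mul cS).div cA hA.ne').mul cch).add (cA.mul (csh.mul crate))

theorem eventually_param (ha : 1 / 2 < a) (s : ℝ) : ∀ᶠ v : ℝ × ℝ in 𝓝 (a, s), 1 / 2 < v.1 :=
  continuousAt_fst.eventually (lt_mem_nhds ha)

theorem defectS_pos (ha : 1 / 2 < a) {s : ℝ} (hs : 0 < s) : 0 < defectS a s := by
  have hB := B_pos ha s
  have h1 := slope_pos ha hs
  have h2 := tanh_ang_pos ha hs
  have h3 := angRate_pos ha s
  have h4 : 0 < 1 - tanh (ang a s) ^ 2 := by linarith [tanh_sq_lt_one (ang a s)]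
  unfold defectS
  positivity

theorem hasDerivAt_s₀ (ha : 1 / 2 < a) :
    HasDerivAt s₀ (-defectParam a (s₀ a) / defectS a (s₀ a)) a := by
  obtain ⟨hs, h0⟩ := s₀_spec ha
  obtain ⟨c1, c2, -, -⟩ := continuousAt_partials ha (s₀ a)
  refine hasDerivAt_of_eventually_unique_zero (f := defect)
    ((eventually_param ha _).mono fun v hv => hasDerivAt_defect_param hv v.2)
    ((eventually_param ha _).mono fun v hv => hasDerivAt_defect hv v.2) c1 c2 h0
    (defectS_pos ha hs).ne' ?_
  filter_upwards [eventually_param ha _, continuousAt_snd.eventually (lt_mem_nhds hs)]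
    with v hv hv2 h
  exact eq_s₀ hv hv2 h

theorem hasDerivAt_height_s₀ (ha : 1 / 2 < a) :
    HasDerivAt (fun x => height x (s₀ x))
      (heightParam a (s₀ a) + heightS a (s₀ a) * (-defectParam a (s₀ a) / defectS a (s₀ a))) a := by
  obtain ⟨-, -, c1, c2⟩ := continuousAt_partials ha (s₀ a)
  have h1 := hasStrictFDerivAt_of_partials (f := height)
    ((eventually_param ha _).mono fun v hv => hasDerivAt_height_param hv v.2)
    ((eventually_param ha _).mono fun v hv => hasDerivAt_height hv v.2) c1 c2
  have h2 := h1.hasFDerivAt.comp_hasDerivAt a ((hasDerivAt_id a).prodMk (hasDerivAt_s₀ ha))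
  refine h2.congr_deriv ?_
  simp
  ring

theorem one_lt_height (ha : 1 / 2 < a) (s : ℝ) : 1 < height a s := by
  have h1 : 1 < A a s := by
    rw [A, lt_sqrt zero_le_one]
    nlinarith [one_le_cosh (2 * s)]
  have h2 := one_le_cosh (ang a s)
  unfold height
  nlinarith

theorem radius_eq (a : ℝ) : radius a = arcosh (height a (s₀ a)) := by
  simp [radius, distPole, lorentz, X, pole, height]

/-- Where the Jacobi function of the family is nonnegative on the boundary, the radius grows: up to
a positive factor its derivative is `(B² - 2 K²) φ + a B² / K`. -/
theorem height_deriv_pos (ha : 1 / 2 < a) (hj : 0 ≤ jac a (s₀ a)) :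
    0 < heightParam a (s₀ a)
      + heightS a (s₀ a) * (-defectParam a (s₀ a) / defectS a (s₀ a)) := by
  obtain ⟨hs, h0⟩ := s₀_spec ha
  have hKB := two_mul_K_sq_lt ha
  set s := s₀ a
  have hA := A_pos ha s
  have hB := B_pos ha s
  have hK := K_pos ha
  have ha0 : 0 < a := by linarith
  have hA2 := A_sq_eq ha s
  have hY2 := sinh_sq_eq ha s
  have hC := cosh_eq ha s
  have hK2 := K_sq ha
  have hY : 0 < a * sinh (2 * s) := mul_pos ha0 (sinh_pos_iff.2 (by linarith))
  have hch := cosh_pos (ang a s)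
  have hth : tanh (ang a s) = K a * B a s / (a * sinh (2 * s)) := by
    rw [defect, slope] at h0
    rw [eq_div_iff hY.ne']
    field_simp at h0
    linarith
  have hsh : sinh (ang a s) = K a * B a s / (a * sinh (2 * s)) * cosh (ang a s) := by
    rw [← hth, tanh_eq_sinh_div_cosh]
    field_simp
  have hS : sinh (2 * s) = a * sinh (2 * s) / a := by field_simp
  have e1 : defectS a s = A a s ^ 2 * K a / (a * sinh (2 * s)) := by
    rw [defectS, hth, slope, angRate]
    exact defect_deriv_algebra hB hY hA2 hY2
  have e2 : heightS a s = A a s * B a s ^ 2 / (a * sinh (2 * s)) * cosh (ang a s) := by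
    rw [heightS, hsh, angRate, ← height_deriv_algebra hA hB hY hA2 hY2]
    ring
  have e3 := radius_deriv_algebra (Φ := angParam a s) hA hB hY hK ha0 hA2 hY2 hC hK2
  rw [← hS] at e3
  have e4 : heightParam a s * defectS a s - heightS a s * defectParam a s
      = cosh (ang a s) * (A a s * B a s ^ 2 * (B a s ^ 2 + 1) / (a * sinh (2 * s)) ^ 3
        * ((B a s ^ 2 - 2 * K a ^ 2) * jac a s + a * B a s ^ 2 / K a)) := by
    rw [jac, ← e3, heightParam, defectParam, e1, e2, hth, hsh, slope]
    ring
  have hd := defectS_pos ha hs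
  have e5 : heightParam a s + heightS a s * (-defectParam a s / defectS a s)
      = (heightParam a s * defectS a s - heightS a s * defectParam a s) / defectS a s := by
    field_simp
    ring
  rw [e5, e4]
  have : 0 ≤ (B a s ^ 2 - 2 * K a ^ 2) * jac a s := mul_nonneg (by linarith) hj
  positivity

theorem radius_hasDerivAt_pos (ha : 1 / 2 < a) (hj : 0 ≤ jac a (s₀ a)) :
    DifferentiableAt ℝ radius a ∧ 0 < deriv radius a := by
  have h1 := one_lt_height ha (s₀ a)
  have h0 := (hasDerivAt_arcosh (mem_Ioi.2 h1)).comp a (hasDerivAt_height_s₀ ha)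
  have h := h0.congr_of_eventuallyEq (f₁ := radius) (.of_forall fun x => radius_eq x)
  refine ⟨h.differentiableAt, ?_⟩
  rw [h.deriv]
  refine mul_pos (inv_pos.2 (sqrt_pos.2 ?_)) (height_deriv_pos ha hj)
  nlinarith

end Partials

/-! ### The second fundamental form -/

section SecondForm

variable {a : ℝ}

theorem deriv_X_s (ha : 1 / 2 < a) (s θ : ℝ) :
    deriv (fun t => X a t θ) s =
      ![a * sinh (2 * s) / A a s * cosh (ang a s) + K a / (A a s * B a s) * sinh (ang a s),
        a * sinh (2 * s) / A a s * sinh (ang a s) + K a / (A a s * B a s) * cosh (ang a s),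
        slope a s * cos θ, slope a s * sin θ] := by
  have hA := A_pos ha s
  have hB := B_pos ha s
  rw [(hasDerivAt_X_s ha s θ).deriv]
  have h : ∀ x, A a s * (x * (K a / (A a s ^ 2 * B a s))) = K a / (A a s * B a s) * x := by
    intro x
    field_simp
  rw [h, h]
  rfl

theorem firstForm_eq (ha : 1 / 2 < a) (s : ℝ) : firstForm a s 0 = !![1, 0; 0, B a s ^ 2] := by
  have hA := A_pos ha s
  have hB := B_pos ha s
  have h1 := A_sq_eq ha s
  have h2 := sinh_sq_eq ha s
  have h3 := cosh_sq (ang a s)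
  simp only [firstForm, deriv_X_s ha, (hasDerivAt_X_theta a s 0).deriv, lorentz, slope]
  simp only [Matrix.cons_val, cos_zero, sin_zero]
  have e : (-((a * sinh (2 * s) / A a s * cosh (ang a s) + K a / (A a s * B a s) * sinh (ang a s))
        * (a * sinh (2 * s) / A a s * cosh (ang a s) + K a / (A a s * B a s) * sinh (ang a s)))
      + (a * sinh (2 * s) / A a s * sinh (ang a s) + K a / (A a s * B a s) * cosh (ang a s))
        * (a * sinh (2 * s) / A a s * sinh (ang a s) + K a / (A a s * B a s) * cosh (ang a s))
      + a * sinh (2 * s) / B a s * 1 * (a * sinh (2 * s) / B a s * 1)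
      + a * sinh (2 * s) / B a s * 0 * (a * sinh (2 * s) / B a s * 0)) = 1 := by
    have e1 : (K a / (A a s * B a s)) ^ 2 - (a * sinh (2 * s) / A a s) ^ 2
        + (a * sinh (2 * s) / B a s) ^ 2 = 1 := by
      rw [div_pow, div_pow, div_pow, h2, mul_pow, h1]
      have : B a s ^ 2 + 1 ≠ 0 := by positivity
      field_simp
      ring
    linear_combination e1 + ((K a / (A a s * B a s)) ^ 2 - (a * sinh (2 * s) / A a s) ^ 2) * h3
  rw [e]
  ext i j
  fin_cases i <;> fin_cases j <;> simp [sq]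

/-- The principal curvature along the profile curve. -/
theorem lorentz_deriv_deriv_X (ha : 1 / 2 < a) (s : ℝ) :
    lorentz (deriv (fun t => deriv (fun t' => X a t' 0) t) s) (normal a s 0)
      = K a / B a s ^ 2 := by
  have hA := A_pos ha s
  have hB := B_pos ha s
  have h1 := A_sq_eq ha s
  have h2 := sinh_sq_eq ha s
  have h3 := cosh_sq (ang a s)
  have h4 := cosh_eq ha s
  have lin : HasDerivAt (fun t : ℝ => 2 * t) 2 s := by
    simpa using (hasDerivAt_id s).const_mul 2
  obtain ⟨α', hα, dα⟩ : ∃ α', α' = (2 * (a * cosh (2 * s)) * A a s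
      - a * sinh (2 * s) * (a * sinh (2 * s) / A a s)) / A a s ^ 2 ∧
      HasDerivAt (fun t => a * sinh (2 * t) / A a t) α' s :=
    ⟨_, rfl, ((lin.sinh.const_mul a).div (hasDerivAt_A ha s) hA.ne').congr_deriv (by ring)⟩
  obtain ⟨β', hβ, dβ⟩ : ∃ β', β' = -(K a * (a * sinh (2 * s) / A a s * B a s
      + A a s * (a * sinh (2 * s) / B a s))) / (A a s * B a s) ^ 2 ∧
      HasDerivAt (fun t => K a / (A a t * B a t)) β' s :=
    ⟨_, rfl, ((hasDerivAt_const s (K a)).div ((hasDerivAt_A ha s).mul (hasDerivAt_B ha s))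
      (mul_pos hA hB).ne').congr_deriv (by simp)⟩
  have dang := hasDerivAt_ang ha s
  have hd : HasDerivAt (fun t => deriv (fun t' => X a t' 0) t)
      ![α' * cosh (ang a s)
          + a * sinh (2 * s) / A a s * (sinh (ang a s) * (K a / (A a s ^ 2 * B a s)))
          + (β' * sinh (ang a s)
            + K a / (A a s * B a s) * (cosh (ang a s) * (K a / (A a s ^ 2 * B a s)))),
        α' * sinh (ang a s)
          + a * sinh (2 * s) / A a s * (cosh (ang a s) * (K a / (A a s ^ 2 * B a s)))
          + (β' * cosh (ang a s)
            + K a / (A a s * B a s) * (sinh (ang a s) * (K a / (A a s ^ 2 * B a s)))),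
        (B a s + K a ^ 2 / B a s ^ 3) * cos 0, (B a s + K a ^ 2 / B a s ^ 3) * sin 0] s := by
    simp only [deriv_X_s ha]
    rw [hasDerivAt_pi]
    intro i
    fin_cases i
    · exact (dα.mul dang.cosh).add (dβ.mul dang.sinh)
    · exact (dα.mul dang.sinh).add (dβ.mul dang.cosh)
    · exact (hasDerivAt_slope ha s).mul_const _
    · exact (hasDerivAt_slope ha s).mul_const _
  rw [hd.deriv]
  simp only [lorentz, normal, Matrix.cons_val, cos_zero, sin_zero]
  have e : -(α' + K a / (A a s * B a s) * (K a / (A a s ^ 2 * B a s))) * (K a / A a s)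
      - (β' + a * sinh (2 * s) / A a s * (K a / (A a s ^ 2 * B a s)))
        * (a * sinh (2 * s) / (A a s * B a s))
      + (B a s + K a ^ 2 / B a s ^ 3) * (K a / B a s) = K a / B a s ^ 2 := by
    rw [hα, hβ, h4]
    generalize a * sinh (2 * s) = Y at *
    have hA4 : A a s ^ 4 = (B a s ^ 2 + 1) ^ 2 := by rw [← h1]; ring
    have hA6 : A a s ^ 6 = (B a s ^ 2 + 1) ^ 3 := by rw [← h1]; ring
    field_simp
    grind
  linear_combination e - ((α' + K a / (A a s * B a s) * (K a / (A a s ^ 2 * B a s)))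
      * (K a / A a s) + (β' + a * sinh (2 * s) / A a s * (K a / (A a s ^ 2 * B a s)))
        * (a * sinh (2 * s) / (A a s * B a s))) * h3

theorem secondForm_eq (ha : 1 / 2 < a) (s : ℝ) :
    secondForm a s 0 = !![K a / B a s ^ 2, 0; 0, -K a] := by
  have hB := B_pos ha s
  have h1 : deriv (fun τ => deriv (fun t => X a t τ) s) 0 = ![0, 0, 0, slope a s] := by
    have h : HasDerivAt (fun τ => deriv (fun t => X a t τ) s)
        ![0, 0, slope a s * -sin 0, slope a s * cos 0] 0 := by
      simp only [deriv_X_s ha]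
      rw [hasDerivAt_pi]
      intro i
      fin_cases i
      · exact hasDerivAt_const _ _
      · exact hasDerivAt_const _ _
      · exact (hasDerivAt_cos 0).const_mul _
      · exact (hasDerivAt_sin 0).const_mul _
    rw [h.deriv]
    simp
  have h2 : deriv (fun τ => deriv (fun τ' => X a s τ') τ) 0 = ![0, 0, -B a s, 0] := by
    have h : HasDerivAt (fun τ => deriv (fun τ' => X a s τ') τ)
        ![0, 0, B a s * -cos 0, B a s * -sin 0] 0 := by
      simp only [(hasDerivAt_X_theta a s _).deriv]
      rw [hasDerivAt_pi]
      intro i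
      fin_cases i
      · exact hasDerivAt_const _ _
      · exact hasDerivAt_const _ _
      · exact (hasDerivAt_sin 0).neg.const_mul _
      · exact (hasDerivAt_cos 0).const_mul _
    rw [h.deriv]
    simp
  simp only [secondForm, lorentz_deriv_deriv_X ha s, h1, h2]
  ext i j
  fin_cases i <;> fin_cases j <;> simp [lorentz, normal]
  field_simp

theorem normSqII_eq (ha : 1 / 2 < a) (s : ℝ) : normSqII a s 0 = 2 * K a ^ 2 / B a s ^ 4 := by
  have hB := B_pos ha s
  have hinv : (!![1, 0; 0, B a s ^ 2] : Matrix (Fin 2) (Fin 2) ℝ)⁻¹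
      = !![1, 0; 0, (B a s ^ 2)⁻¹] := by
    refine Matrix.inv_eq_right_inv ?_
    ext i j
    fin_cases i <;> fin_cases j <;> simp [Matrix.mul_apply, Fin.sum_univ_two, hB.ne']
  rw [normSqII, firstForm_eq ha, secondForm_eq ha, hinv, sq]
  simp [Matrix.trace, Fin.sum_univ_two]
  field_simp
  ring

theorem W_zero_eq (ha : 1 / 2 < a) (s : ℝ) : W 0 a s = 2 * K a ^ 2 / B a s ^ 4 - 2 := by
  simp [W, normSqII_eq ha]

end SecondForm

/-! ### The Jacobi equation -/

section Jacobi

variable {a : ℝ}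

/-- `B` times the `s`-derivative of `jac`. -/
def jacFlux (a s : ℝ) : ℝ :=
  -(a * sinh (2 * s) * (2 * K a ^ 2 * B a s ^ 2 + K a ^ 2 + B a s ^ 2))
      / (4 * a * K a * B a s ^ 3 * A a s ^ 2)
    - (B a s ^ 2 + K a ^ 2 / B a s ^ 2) * angParam a s

theorem hasDerivAt_sinh_two_mul (a s : ℝ) :
    HasDerivAt (fun t => a * sinh (2 * t)) (2 * (a * cosh (2 * s))) s := by
  have lin : HasDerivAt (fun t : ℝ => 2 * t) 2 s := by
    simpa using (hasDerivAt_id s).const_mul 2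
  exact (lin.sinh.const_mul a).congr_deriv (by ring)

theorem angRateParam_eq (ha : 1 / 2 < a) (s : ℝ) :
    angRateParam a s = a / (K a * (A a s ^ 2 * B a s)) - K a * ((B a s ^ 2 + 1 / 2) / a)
      * (1 / (A a s ^ 4 * B a s) + 1 / (2 * A a s ^ 2 * B a s ^ 3)) := by
  have : cosh (2 * s) = (B a s ^ 2 + 1 / 2) / a := by
    rw [← cosh_eq ha s, mul_div_cancel_left₀]
    linarith
  rw [angRateParam, this]

/-- The derivative of `jac`; the form of `jacFlux` is what remains after cancelling the factor
`B² B'²` by the first integral of the profile equation. -/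
theorem hasDerivAt_jac (ha : 1 / 2 < a) (s : ℝ) :
    HasDerivAt (jac a) (jacFlux a s / B a s) s := by
  have hA := A_pos ha s
  have hB := B_pos ha s
  have hK := K_pos ha
  have ha0 : 0 < a := by linarith
  have h1 := A_sq_eq ha s
  have h2 := sinh_sq_eq ha s
  have h4 := cosh_eq ha s
  have hK2 := K_sq ha
  have e : jac a = fun t => K a / (2 * a) * ((B a t ^ 2 + 1 / 2) / (A a t ^ 2 * B a t ^ 2))
      - slope a t * angParam a t := by
    ext t
    have := A_pos ha t
    have := B_pos ha t
    rw [jac, slope, ← cosh_eq ha t]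
    field_simp
  rw [e]
  have h := (((((hasDerivAt_B ha s).pow 2).add_const (1 / 2)).div
    (((hasDerivAt_A ha s).pow 2).mul ((hasDerivAt_B ha s).pow 2))
      (by have := mul_pos (pow_pos hA 2) (pow_pos hB 2); exact this.ne')).const_mul
        (K a / (2 * a))).sub ((hasDerivAt_slope ha s).mul (hasDerivAt_angParam ha s))
  refine h.congr_deriv ?_
  rw [angRateParam_eq ha, slope, jacFlux]
  simp only [Pi.mul_apply, Pi.pow_apply]
  generalize a * sinh (2 * s) = Y at *
  have hA4 : A a s ^ 4 = (B a s ^ 2 + 1) ^ 2 := by rw [← h1]; ring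
  field_simp
  grind

/-- The Jacobi equation for the variation field of the family. -/
theorem hasDerivAt_jacFlux (ha : 1 / 2 < a) (s : ℝ) :
    HasDerivAt (jacFlux a) (-(B a s * W 0 a s * jac a s)) s := by
  have hA := A_pos ha s
  have hB := B_pos ha s
  have hK := K_pos ha
  have ha0 : 0 < a := by linarith
  have h1 := A_sq_eq ha s
  have h2 := sinh_sq_eq ha s
  have h4 := cosh_eq ha s
  have hK2 := K_sq ha
  have hC : cosh (2 * s) = (B a s ^ 2 + 1 / 2) / a := by
    rw [← h4, mul_div_cancel_left₀ _ ha0.ne']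
  have dB2 := (hasDerivAt_B ha s).pow 2
  have h := ((((hasDerivAt_sinh_two_mul a s).mul
    ((dB2.const_mul (2 * K a ^ 2)).add_const (K a ^ 2) |>.add dB2)).neg).div
      ((((hasDerivAt_B ha s).pow 3).const_mul (4 * a * K a)).mul ((hasDerivAt_A ha s).pow 2))
        (by
          have := mul_pos (mul_pos (by positivity : 0 < 4 * a * K a) (pow_pos hB 3)) (pow_pos hA 2)
          exact this.ne')).sub
    ((dB2.add ((hasDerivAt_const s (K a ^ 2)).div dB2 (pow_pos hB 2).ne')).mul
      (hasDerivAt_angParam ha s))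
  refine h.congr_deriv ?_
  rw [angRateParam_eq ha, W_zero_eq ha, jac, h4, hC]
  simp only [Pi.mul_apply, Pi.pow_apply, Pi.add_apply, Pi.div_apply, Pi.neg_apply]
  generalize a * sinh (2 * s) = Y at *
  have hA4 : A a s ^ 4 = (B a s ^ 2 + 1) ^ 2 := by rw [← h1]; ring
  field_simp
  grind

end Jacobi

/-! ### Bilinearity of the radial forms -/

section Forms

open MeasureTheory

variable {a : ℝ}

theorem continuous_B (a : ℝ) : Continuous (B a) :=
  continuous_B_uncurry.comp (Continuous.prodMk_right a)

theorem continuous_W_zero (ha : 1 / 2 < a) : Continuous (W 0 a) := by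
  have h : W 0 a = fun s => 2 * K a ^ 2 / B a s ^ 4 - 2 := funext fun s => W_zero_eq ha s
  rw [h]
  exact (continuous_const.div ((continuous_B a).pow 4) fun s =>
    (pow_pos (B_pos ha s) 4).ne').sub continuous_const

theorem hasDerivAt_of_contDiffOn {b : ℝ} {u : ℝ → ℝ} (hu : ContDiffOn ℝ 2 u (Icc (-b) b)) {s : ℝ}
    (hs : s ∈ Ioo (-b) b) : HasDerivAt u (deriv u s) s :=
  (((hu.differentiableOn (by norm_num)) s (Ioo_subset_Icc_self hs)).differentiableAt
    (Icc_mem_nhds hs.1 hs.2)).hasDerivAt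

/-- The integrand of `radForm` is integrable, because the derivatives of the arguments agree in the
interior with one-sided derivatives that are continuous up to the boundary. -/
theorem intervalIntegrable_radForm (ha : 1 / 2 < a) {b : ℝ} (hb : 0 < b) {u v : ℝ → ℝ}
    (hu : ContDiffOn ℝ 2 u (Icc (-b) b)) (hv : ContDiffOn ℝ 2 v (Icc (-b) b)) :
    IntervalIntegrable
      (fun s => B a s * (deriv u s * deriv v s) - B a s * W 0 a s * (u s * v s)) volume (-b) b := by
  have hbb : -b < b := by linarith
  have hB := (continuous_B a).continuousOn (s := Icc (-b) b)
  have hW := (continuous_W_zero ha).continuousOn (s := Icc (-b) b)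
  have du := hu.continuousOn_derivWithin (uniqueDiffOn_Icc hbb) (by norm_num)
  have dv := hv.continuousOn_derivWithin (uniqueDiffOn_Icc hbb) (by norm_num)
  have hc : ContinuousOn (fun s => B a s * (derivWithin u (Icc (-b) b) s
      * derivWithin v (Icc (-b) b) s) - B a s * W 0 a s * (u s * v s)) (Icc (-b) b) :=
    (hB.mul (du.mul dv)).sub ((hB.mul hW).mul (hu.continuousOn.mul hv.continuousOn))
  refine (hc.intervalIntegrable_of_Icc hbb.le).congr_uIoo fun s hs => ?_
  rw [uIoo_of_le hbb.le] at hs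
  simp only [derivWithin_of_mem_nhds (Icc_mem_nhds hs.1 hs.2)]

theorem intervalIntegrable_radInner {b : ℝ} (hb : 0 < b) {u v : ℝ → ℝ}
    (hu : ContinuousOn u (Icc (-b) b)) (hv : ContinuousOn v (Icc (-b) b)) :
    IntervalIntegrable (fun s => B a s * (u s * v s)) volume (-b) b :=
  ((continuous_B a).continuousOn.mul (hu.mul hv)).intervalIntegrable_of_Icc (by linarith)

theorem radForm_comm (k : ℤ) (a : ℝ) (u v : ℝ → ℝ) : radForm k a u v = radForm k a v u := by
  simp only [radForm, mul_comm (u _) (v _), mul_comm (deriv u _) (deriv v _)]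

theorem radInner_comm (a : ℝ) (u v : ℝ → ℝ) : radInner a u v = radInner a v u := by
  simp only [radInner, mul_comm (u _) (v _)]

theorem radForm_sum_left (ha : 1 / 2 < a) {ι : Type*} [Fintype ι] (c : ι → ℝ) {u : ι → ℝ → ℝ}
    (hu : ∀ i, ContDiffOn ℝ 2 (u i) (Icc (-s₀ a) (s₀ a))) {v : ℝ → ℝ}
    (hv : ContDiffOn ℝ 2 v (Icc (-s₀ a) (s₀ a))) :
    radForm 0 a (fun s => ∑ i, c i * u i s) v = ∑ i, c i * radForm 0 a (u i) v := by
  have hb := (s₀_spec ha).1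
  have h1 : (∫ s in (-s₀ a)..(s₀ a), (B a s * (deriv (fun s => ∑ i, c i * u i s) s * deriv v s)
        - B a s * W 0 a s * ((∑ i, c i * u i s) * v s)))
      = ∫ s in (-s₀ a)..(s₀ a), ∑ i, c i * (B a s * (deriv (u i) s * deriv v s)
        - B a s * W 0 a s * (u i s * v s)) := by
    refine intervalIntegral.integral_congr_Ioo_of_le (by linarith) fun s hs => ?_
    have hd : HasDerivAt (fun s => ∑ i, c i * u i s) (∑ i, c i * deriv (u i) s) s :=
      HasDerivAt.fun_sum fun i _ => (hasDerivAt_of_contDiffOn (hu i) hs).const_mul (c i)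
    simp only [hd.deriv, Finset.sum_mul, Finset.mul_sum, ← Finset.sum_sub_distrib]
    exact Finset.sum_congr rfl fun i _ => by ring
  unfold radForm
  rw [h1, intervalIntegral.integral_finsetSum fun i _ =>
    (intervalIntegrable_radForm ha hb (hu i) hv).const_mul (c i)]
  simp only [intervalIntegral.integral_const_mul]
  rw [Finset.sum_mul, Finset.sum_mul, ← Finset.sum_add_distrib, Finset.mul_sum,
    ← Finset.sum_sub_distrib]
  exact Finset.sum_congr rfl fun i _ => by ring

theorem radInner_sum_left (ha : 1 / 2 < a) {ι : Type*} [Fintype ι] (c : ι → ℝ) {u : ι → ℝ → ℝ}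
    (hu : ∀ i, ContinuousOn (u i) (Icc (-s₀ a) (s₀ a))) {v : ℝ → ℝ}
    (hv : ContinuousOn v (Icc (-s₀ a) (s₀ a))) :
    radInner a (fun s => ∑ i, c i * u i s) v = ∑ i, c i * radInner a (u i) v := by
  have hb := (s₀_spec ha).1
  have h1 : radInner a (fun s => ∑ i, c i * u i s) v
      = ∫ s in (-s₀ a)..(s₀ a), ∑ i, c i * (B a s * (u i s * v s)) := by
    refine intervalIntegral.integral_congr fun s _ => ?_
    simp only [Finset.sum_mul, Finset.mul_sum]
    exact Finset.sum_congr rfl fun i _ => by ring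
  rw [h1, intervalIntegral.integral_finsetSum fun i _ =>
    (intervalIntegrable_radInner hb (hu i) hv).const_mul (c i)]
  simp only [intervalIntegral.integral_const_mul, radInner]

theorem radInner_self_nonneg (ha : 1 / 2 < a) (u : ℝ → ℝ) : 0 ≤ radInner a u u :=
  intervalIntegral.integral_nonneg (by linarith [(s₀_spec ha).1]) fun s _ =>
    mul_nonneg (B_pos ha s).le (mul_self_nonneg _)

theorem radInner_self_pos (ha : 1 / 2 < a) {u : ℝ → ℝ}
    (hu : ContinuousOn u (Icc (-s₀ a) (s₀ a))) {s : ℝ} (hs : s ∈ Icc (-s₀ a) (s₀ a))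
    (hus : u s ≠ 0) : 0 < radInner a u u := by
  have hb := (s₀_spec ha).1
  exact intervalIntegral.integral_pos (by linarith) ((continuous_B a).continuousOn.mul (hu.mul hu))
    (fun t _ => mul_nonneg (B_pos ha t).le (mul_self_nonneg _))
    ⟨s, hs, mul_pos (B_pos ha s) (mul_self_pos.2 hus)⟩

/-- Eigenfunctions with different eigenvalues are orthogonal. -/
theorem IsEigenfunction.radInner_eq_zero {k : ℤ} {μ ν : ℝ} {u v : ℝ → ℝ}
    (hu : IsEigenfunction k a μ u) (hv : IsEigenfunction k a ν v) (h : μ ≠ ν) :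
    radInner a u v = 0 := by
  have h1 := hu.2 v hv.1
  have h2 := hv.2 u hu.1
  rw [radForm_comm, radInner_comm, h1] at h2
  have h3 : (μ - ν) * radInner a u v = 0 := by linarith
  exact (mul_eq_zero.1 h3).resolve_left (sub_ne_zero.2 h)

end Forms

/-! ### The spectral gap -/

section Gap

open MeasureTheory

variable {a : ℝ}

theorem continuous_jac (ha : 1 / 2 < a) : Continuous (jac a) :=
  continuous_iff_continuousAt.2 fun s => (hasDerivAt_jac ha s).continuousAt

theorem continuous_jacFlux (ha : 1 / 2 < a) : Continuous (jacFlux a) :=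
  continuous_iff_continuousAt.2 fun s => (hasDerivAt_jacFlux ha s).continuousAt

/-- If the Jacobi function `φ` of the family is positive, the form of mode `0` is bounded below by
a positive multiple of the inner product on the functions that vanish at the boundary. The proof
completes a square with the function `φ' / φ - ε s / (B φ²)`, which solves a strict Riccati
inequality. -/
theorem exists_dirichlet_gap (ha : 1 / 2 < a) (hpos : ∀ s ∈ Icc 0 (s₀ a), 0 < jac a s) :
    ∃ δ, 0 < δ ∧ ∀ u : ℝ → ℝ, ContDiffOn ℝ 2 u (Icc (-s₀ a) (s₀ a)) → u (s₀ a) = 0 →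
      u (-s₀ a) = 0 → δ * radInner a u u ≤ radForm 0 a u u := by
  have hb := (s₀_spec ha).1
  have hj : ∀ s ∈ Icc (-s₀ a) (s₀ a), 0 < jac a s := fun s hs => by
    rcases le_total 0 s with h | h
    · exact hpos s ⟨h, hs.2⟩
    · rw [← jac_neg]
      exact hpos (-s) ⟨by linarith, by linarith [hs.1]⟩
  have hcj := (continuous_jac ha).continuousOn (s := Icc (-s₀ a) (s₀ a))
  have hcB := (continuous_B a).continuousOn (s := Icc (-s₀ a) (s₀ a))
  -- The parameter `ε` makes the quadratic error term at most half of the linear gain.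
  obtain ⟨M, hM⟩ := isCompact_Icc.exists_bound_of_continuousOn
    ((continuousOn_id.pow 2).div (hcB.mul (hcj.pow 2)) fun s hs =>
      (mul_pos (B_pos ha s) (pow_pos (hj s hs) 2)).ne')
  obtain ⟨N, hN⟩ := isCompact_Icc.exists_bound_of_continuousOn (hcB.mul (hcj.pow 2))
  set ε := 1 / (2 * (|M| + 1)) with hε
  have hε0 : 0 < ε := by positivity
  set δ := ε / (2 * (|N| + 1)) with hδ
  refine ⟨δ, by positivity, fun u hu hu1 hu2 => ?_⟩
  set h : ℝ → ℝ := fun s => jacFlux a s / jac a s - ε * s / jac a s ^ 2 with hh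
  have hch : ContinuousOn h (Icc (-s₀ a) (s₀ a)) :=
    ((continuous_jacFlux ha).continuousOn.div hcj fun s hs => (hj s hs).ne').sub
      ((continuousOn_const.mul continuousOn_id).div (hcj.pow 2)
        fun s hs => (pow_pos (hj s hs) 2).ne')
  have hint : IntervalIntegrable (fun s => (B a s * (deriv u s * deriv u s)
      - B a s * W 0 a s * (u s * u s)) - δ * (B a s * (u s * u s))) volume (-s₀ a) (s₀ a) :=
    (intervalIntegrable_radForm ha hb hu hu).sub
      ((intervalIntegrable_radInner hb hu.continuousOn hu.continuousOn).const_mul δ)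
  have key := intervalIntegral.sub_le_integral_of_hasDeriv_right_of_le
    (a := -s₀ a) (b := s₀ a) (g := fun s => h s * u s ^ 2)
    (g' := fun s => ((-(B a s * W 0 a s * jac a s) * jac a s
        - jacFlux a s * (jacFlux a s / B a s)) / jac a s ^ 2
      - (ε * jac a s ^ 2 - ε * s * (2 * jac a s * (jacFlux a s / B a s))) / (jac a s ^ 2) ^ 2)
        * u s ^ 2 + h s * (2 * u s * deriv u s))
    (φ := fun s => (B a s * (deriv u s * deriv u s)
      - B a s * W 0 a s * (u s * u s)) - δ * (B a s * (u s * u s)))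
    (by linarith) (hch.mul (hu.continuousOn.pow 2)) ?_ ?_ ?_
  · simp only [hu1, hu2] at key
    rw [intervalIntegral.integral_sub (intervalIntegrable_radForm ha hb hu hu)
      ((intervalIntegrable_radInner hb hu.continuousOn hu.continuousOn).const_mul δ),
      intervalIntegral.integral_const_mul] at key
    simp only [radForm, radInner, hu1, hu2]
    linarith
  · intro s hs
    have hjs := hj s (Ioo_subset_Icc_self hs)
    have d1 := (hasDerivAt_jacFlux ha s).div (hasDerivAt_jac ha s) hjs.ne'
    have d2 := ((hasDerivAt_id s).const_mul ε).div ((hasDerivAt_jac ha s).pow 2)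
      (pow_pos hjs 2).ne'
    have d3 := (d1.sub d2).mul ((hasDerivAt_of_contDiffOn hu hs).pow 2)
    refine (d3.congr_deriv ?_).hasDerivWithinAt
    simp [hh]
  · rwa [intervalIntegrable_iff_integrableOn_Icc_of_le (by linarith)] at hint
  · intro s hs
    have hs' := Ioo_subset_Icc_self hs
    have hjs := hj s hs'
    have hB := B_pos ha s
    have hMs := (le_abs_self _).trans ((hM s hs').trans (le_abs_self M))
    have hNs := (le_abs_self _).trans ((hN s hs').trans (le_abs_self N))
    simp only [id, Pi.pow_apply, Pi.mul_apply, Pi.div_apply] at hMs hNs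
    -- The difference of the two sides is `B (u' - (h / B) u)²` plus a positive multiple of `u²`.
    have gap : δ * B a s ≤ ε / jac a s ^ 2 * (1 - ε * (s ^ 2 / (B a s * jac a s ^ 2))) := by
      have e1 : ε * (s ^ 2 / (B a s * jac a s ^ 2)) ≤ 1 / 2 := by
        have : ε * (s ^ 2 / (B a s * jac a s ^ 2)) ≤ ε * |M| := by gcongr
        refine this.trans ?_
        rw [hε, div_mul_eq_mul_div, div_le_div_iff₀ (by positivity) (by norm_num)]
        linarith [abs_nonneg M]
      have e2 : δ * B a s ≤ ε / jac a s ^ 2 * (1 / 2) := by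
        rw [hδ, div_mul_eq_mul_div, div_mul_div_comm, div_le_div_iff₀ (by positivity)
          (by positivity)]
        have : ε * (B a s * jac a s ^ 2) ≤ ε * |N| := by gcongr
        linarith
      refine e2.trans ?_
      gcongr
      linarith
    have gap2 := mul_le_mul_of_nonneg_right gap (sq_nonneg (u s))
    have sq : 0 ≤ B a s * (deriv u s - h s / B a s * u s) ^ 2 := by positivity
    have id : (B a s * (deriv u s * deriv u s) - B a s * W 0 a s * (u s * u s))
        - (((-(B a s * W 0 a s * jac a s) * jac a s
          - jacFlux a s * (jacFlux a s / B a s)) / jac a s ^ 2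
        - (ε * jac a s ^ 2 - ε * s * (2 * jac a s * (jacFlux a s / B a s))) / (jac a s ^ 2) ^ 2)
          * u s ^ 2 + h s * (2 * u s * deriv u s))
        = B a s * (deriv u s - h s / B a s * u s) ^ 2
          + ε / jac a s ^ 2 * (1 - ε * (s ^ 2 / (B a s * jac a s ^ 2))) * u s ^ 2 := by
      simp only [hh]
      field_simp
      ring
    linarith

/-- Two boundary conditions cut a space of three eigenfunctions down to a nonzero function that
vanishes at the boundary, so the third eigenvalue is at least the Dirichlet gap. -/
theorem le_of_hasEigenvaluesLE (ha : 1 / 2 < a) {δ x : ℝ}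
    (hδ : ∀ u : ℝ → ℝ, ContDiffOn ℝ 2 u (Icc (-s₀ a) (s₀ a)) → u (s₀ a) = 0 →
      u (-s₀ a) = 0 → δ * radInner a u u ≤ radForm 0 a u u)
    (hx : HasEigenvaluesLE 0 a 3 x) : δ ≤ x := by
  obtain ⟨ev, u, hu, hli⟩ := hx
  have hb := (s₀_spec ha).1
  -- A nontrivial combination of the eigenfunctions that vanishes at both endpoints.
  obtain ⟨c, hc0, hc1, hc2⟩ : ∃ c : Fin 3 → ℝ, c ≠ 0 ∧ ∑ i, c i * u i (s₀ a) = 0 ∧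
      ∑ i, c i * u i (-s₀ a) = 0 := by
    let L : (Fin 3 → ℝ) →ₗ[ℝ] (Fin 2 → ℝ) :=
      Matrix.mulVecLin (Matrix.of ![fun i => u i (s₀ a), fun i => u i (-s₀ a)])
    obtain ⟨c, hc, hc0⟩ := (Submodule.ne_bot_iff _).1
      (LinearMap.ker_ne_bot_of_finrank_lt (f := L) (by simp))
    have hz : L c = 0 := hc
    refine ⟨c, hc0, ?_, ?_⟩
    · have := congrFun hz 0
      simp only [L, Matrix.mulVecLin_apply, Matrix.mulVec, dotProduct, Matrix.of_apply,
        Matrix.cons_val, Pi.zero_apply] at this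
      simpa only [mul_comm] using this
    · have := congrFun hz 1
      simp only [L, Matrix.mulVecLin_apply, Matrix.mulVec, dotProduct, Matrix.of_apply,
        Matrix.cons_val, Pi.zero_apply] at this
      simpa only [mul_comm] using this
  have hC : ∀ i, ContDiffOn ℝ 2 (u i) (Icc (-s₀ a) (s₀ a)) := fun i => (hu i).2.1
  set w : ℝ → ℝ := fun s => ∑ i, c i * u i s with hw
  have hwC : ContDiffOn ℝ 2 w (Icc (-s₀ a) (s₀ a)) :=
    ContDiffOn.sum fun i _ => contDiffOn_const.mul (hC i)
  have hin : ∀ v : ℝ → ℝ, ContinuousOn v (Icc (-s₀ a) (s₀ a)) → ∀ d : Fin 3 → ℝ,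
      radInner a (fun s => ∑ i, d i * u i s) v = ∑ i, d i * radInner a (u i) v := fun v hv d =>
    radInner_sum_left ha d (fun i => (hC i).continuousOn) hv
  have hsum : ∀ d : Fin 3 → ℝ, ContinuousOn (fun s => ∑ i, d i * u i s) (Icc (-s₀ a) (s₀ a)) :=
    fun d => continuousOn_finsetSum _ fun i _ => continuousOn_const.mul (hC i).continuousOn
  have hdd : ∀ d e : Fin 3 → ℝ, ∑ i, d i * radInner a (u i) (fun s => ∑ j, e j * u j s)
      = ∑ i, ∑ j, d i * e j * radInner a (u i) (u j) := fun d e => by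
    refine Finset.sum_congr rfl fun i _ => ?_
    rw [radInner_comm, hin _ (hC i).continuousOn, Finset.mul_sum]
    exact Finset.sum_congr rfl fun j _ => by rw [radInner_comm a (u j)]; ring
  -- On the span the form is at most `x` times the inner product: the difference is the squared
  -- norm of the combination with coefficients `c i * √(x - ev i)`, by orthogonality.
  have hle : radForm 0 a w w ≤ x * radInner a w w := by
    have h1 : radForm 0 a w w = ∑ i, ∑ j, (c i * ev i) * c j * radInner a (u i) (u j) := by
      rw [← hdd, hw, radForm_sum_left ha c hC hwC]
      exact Finset.sum_congr rfl fun i _ => by rw [(hu i).2.2 w hwC, mul_assoc]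
    have h2 : radInner a w w = ∑ i, ∑ j, c i * c j * radInner a (u i) (u j) := by
      rw [← hdd, hw, hin w hwC.continuousOn c]
    have h3 := radInner_self_nonneg ha (fun s => ∑ i, (c i * √(x - ev i)) * u i s)
    rw [hin _ (hsum _), hdd] at h3
    have h4 : x * radInner a w w - radForm 0 a w w
        = ∑ i, ∑ j, c i * √(x - ev i) * (c j * √(x - ev j)) * radInner a (u i) (u j) := by
      rw [h1, h2, Finset.mul_sum, ← Finset.sum_sub_distrib]
      refine Finset.sum_congr rfl fun i _ => ?_
      rw [Finset.mul_sum, ← Finset.sum_sub_distrib]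
      refine Finset.sum_congr rfl fun j _ => ?_
      by_cases hij : ev i = ev j
      · have := mul_self_sqrt (sub_nonneg.2 (hu j).1)
        rw [hij]
        linear_combination -(c i * c j * radInner a (u i) (u j)) * this
      · rw [(hu i).2.radInner_eq_zero (hu j).2 hij]
        ring
    linarith
  have hge := hδ w hwC hc1 hc2
  have hpos : 0 < radInner a w w := by
    by_contra hn
    refine hc0 (Fintype.linearIndependent_iff.1 hli c ?_ |> funext)
    ext s
    by_contra hs
    refine hn (radInner_self_pos ha hwC.continuousOn s.2 fun h => hs ?_)
    simpa [hw] using h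
  exact le_of_mul_le_mul_right (hge.trans hle) hpos

end Gap

/-! ### Existence of eigenvalues -/

section Existence

open MeasureTheory

variable {a : ℝ}

/-- The substitution `u = v / √B` turns `(B u')' + B W u + k² B u = 0` into
`v'' = (liouvillePotential - k²) v`. The first summand is `(√B)'' / √B`. -/
def liouvillePotential (a s : ℝ) : ℝ :=
  (B a s + K a ^ 2 / B a s ^ 3) / (2 * B a s) - slope a s ^ 2 / (4 * B a s ^ 2) - W 0 a s

theorem continuous_slope (ha : 1 / 2 < a) : Continuous (slope a) :=
  continuous_iff_continuousAt.2 fun s => (hasDerivAt_slope ha s).continuousAt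

theorem continuous_liouvillePotential (ha : 1 / 2 < a) : Continuous (liouvillePotential a) := by
  have hB := continuous_B a
  have hB0 : ∀ s, 0 < B a s := B_pos ha
  exact (((hB.add (continuous_const.div (hB.pow 3) fun s => (pow_pos (hB0 s) 3).ne')).div
    (continuous_const.mul hB) fun s => (mul_pos two_pos (hB0 s)).ne').sub
      (((continuous_slope ha).pow 2).div (continuous_const.mul (hB.pow 2))
        fun s => (mul_pos four_pos (pow_pos (hB0 s) 2)).ne')).sub (continuous_W_zero ha)

theorem contDiff_sqrt_B (ha : 1 / 2 < a) : ContDiff ℝ 2 fun s => √(B a s) := by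
  have hB : ContDiff ℝ 2 (B a) :=
    ContDiff.sqrt (by fun_prop) fun s => (B_arg_pos ha s).ne'
  exact hB.sqrt fun s => (B_pos ha s).ne'

theorem contDiff_two_of_hasDerivAt {v v' v'' : ℝ → ℝ} (h0 : ∀ s, HasDerivAt v (v' s) s)
    (h1 : ∀ s, HasDerivAt v' (v'' s) s) (h2 : Continuous v'') : ContDiff ℝ 2 v := by
  have e0 : deriv v = v' := funext fun s => (h0 s).deriv
  have e1 : deriv v' = v'' := funext fun s => (h1 s).deriv
  have c1 : ContDiff ℝ 1 v' :=
    contDiff_one_iff_deriv.2 ⟨fun s => (h1 s).differentiableAt, e1 ▸ h2⟩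
  rw [show (2 : WithTop ℕ∞) = 1 + 1 by norm_num, contDiff_succ_iff_deriv]
  exact ⟨fun s => (h0 s).differentiableAt, by simp, e0 ▸ c1⟩

/-- A solution of the Liouville-transformed Robin problem gives an eigenfunction. -/
theorem isEigenfunction_div_sqrt_B (ha : 1 / 2 < a) {k : ℝ} {v v' v'' : ℝ → ℝ}
    (hv'' : Continuous v'') (hv : ∀ s, HasDerivAt v (v' s) s)
    (hv' : ∀ s, HasDerivAt v' (v'' s) s)
    (heq : ∀ s ∈ Icc (-s₀ a) (s₀ a), v'' s = (liouvillePotential a s - k ^ 2) * v s)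
    (hr : v' (s₀ a) = (cosh (radius a) / sinh (radius a)
      + slope a (s₀ a) / (2 * B a (s₀ a))) * v (s₀ a))
    (hl : v' (-s₀ a) = (-(cosh (radius a) / sinh (radius a))
      + slope a (-s₀ a) / (2 * B a (-s₀ a))) * v (-s₀ a)) :
    IsEigenfunction 0 a (k ^ 2) fun s => v s / √(B a s) := by
  have hb := (s₀_spec ha).1
  have hB : ∀ s, 0 < B a s := B_pos ha
  have hg : ∀ s, 0 < √(B a s) := fun s => sqrt_pos.2 (hB s)
  have hg2 : ∀ s, √(B a s) ^ 2 = B a s := fun s => sq_sqrt (hB s).le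
  have hu : ContDiff ℝ 2 fun s => v s / √(B a s) :=
    (contDiff_two_of_hasDerivAt hv hv' hv'').div (contDiff_sqrt_B ha) fun s => (hg s).ne'
  have dg : ∀ s, HasDerivAt (fun s => √(B a s)) (slope a s / (2 * √(B a s))) s := fun s =>
    (hasDerivAt_B ha s).sqrt (hB s).ne'
  have du : ∀ s, HasDerivAt (fun s => v s / √(B a s))
      ((v' s - slope a s / (2 * B a s) * v s) / √(B a s)) s := fun s => by
    refine ((hv s).div (dg s) (hg s).ne').congr_deriv ?_
    have := hg s
    have := hB s
    rw [hg2]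
    field_simp
    rw [hg2]
    ring
  set flux : ℝ → ℝ := fun s => √(B a s) * (v' s - slope a s / (2 * B a s) * v s) with hflux
  have fluxu : ∀ s, flux s = B a s * ((v' s - slope a s / (2 * B a s) * v s) / √(B a s)) :=
    fun s => by
      have := hg s
      simp only [hflux]
      field_simp
      rw [hg2]
  have dflux : ∀ s ∈ Icc (-s₀ a) (s₀ a),
      HasDerivAt flux (-(B a s * (W 0 a s + k ^ 2) * (v s / √(B a s)))) s := fun s hs => by
    have h2B : 2 * B a s ≠ 0 := (mul_pos two_pos (hB s)).ne'
    refine ((dg s).mul ((hv' s).sub ((((hasDerivAt_slope ha s).div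
      ((hasDerivAt_B ha s).const_mul 2) h2B)).mul (hv s)))).congr_deriv ?_
    have e : a * sinh (2 * s) / B a s = slope a s := rfl
    rw [heq s hs, liouvillePotential, e]
    simp only [Pi.sub_apply, Pi.mul_apply, Pi.div_apply]
    have h1 := hg s
    have h2 := hB s
    have h3 := hg2 s
    generalize √(B a s) = g at *
    generalize B a s = b at *
    subst h3
    field_simp
    ring
  refine ⟨hu.contDiffOn, fun f hf => ?_⟩
  have huC := hu.contDiffOn (s := Icc (-s₀ a) (s₀ a))
  have ibp := intervalIntegral.integral_eq_sub_of_hasDerivAt_of_le (a := -s₀ a) (b := s₀ a)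
    (f := fun s => flux s * f s)
    (f' := fun s => (B a s * (deriv (fun s => v s / √(B a s)) s * deriv f s)
      - B a s * W 0 a s * (v s / √(B a s) * f s)) - k ^ 2 * (B a s * (v s / √(B a s) * f s)))
    (by linarith)
    (ContinuousOn.mul (f := flux)
      (fun s hs => (dflux s hs).continuousAt.continuousWithinAt) hf.continuousOn) ?_
    ((intervalIntegrable_radForm ha hb huC hf).sub
      ((intervalIntegrable_radInner hb huC.continuousOn hf.continuousOn).const_mul (k ^ 2)))
  · rw [intervalIntegral.integral_sub (intervalIntegrable_radForm ha hb huC hf)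
      ((intervalIntegrable_radInner hb huC.continuousOn hf.continuousOn).const_mul (k ^ 2)),
      intervalIntegral.integral_const_mul, fluxu, fluxu, hr, hl, B_neg] at ibp
    simp only [radForm, radInner]
    rw [B_neg]
    linear_combination ibp
  · intro s hs
    have hs' := Ioo_subset_Icc_self hs
    refine ((dflux s hs').mul (hasDerivAt_of_contDiffOn hf hs)).congr_deriv ?_
    rw [(du s).deriv, fluxu]
    ring

/-- There are arbitrarily large eigenvalues. -/
theorem exists_eigenfunction (ha : 1 / 2 < a) (N : ℝ) :
    ∃ k, N < k ∧ 0 < k ∧ ∃ u : ℝ → ℝ, IsEigenfunction 0 a (k ^ 2) u ∧ u (-s₀ a) ≠ 0 := by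
  have hb := (s₀_spec ha).1
  obtain ⟨k, hN, hk, v, v', v'', hc, hv, hv', heq, h0, hl, hr⟩ := exists_robin_solution
    (q := fun t => liouvillePotential a (t - s₀ a))
    ((continuous_liouvillePotential ha).comp (continuous_id.sub continuous_const))
    (show 0 < 2 * s₀ a by linarith)
    (-(cosh (radius a) / sinh (radius a)) + slope a (-s₀ a) / (2 * B a (-s₀ a)))
    (cosh (radius a) / sinh (radius a) + slope a (s₀ a) / (2 * B a (s₀ a))) N
  have e1 : s₀ a + s₀ a = 2 * s₀ a := by ring
  have e2 : -s₀ a + s₀ a = 0 := by ring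
  refine ⟨k, hN, hk, fun s => v (s + s₀ a) / √(B a s), ?_, ?_⟩
  · refine isEigenfunction_div_sqrt_B ha (v := fun s => v (s + s₀ a))
      (v' := fun s => v' (s + s₀ a)) (v'' := fun s => v'' (s + s₀ a))
      (hc.comp (continuous_id.add continuous_const)) (fun s => (hv _).comp_add_const s _)
      (fun s => (hv' _).comp_add_const s _) (fun s hs => ?_) ?_ ?_
    · have := heq (s + s₀ a) ⟨by linarith [hs.1], by linarith [hs.2]⟩
      simpa using this
    · simp only [e1]
      exact hr
    · simp only [e2, h0, hl, mul_one]
  · simp only [e2, h0]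
    exact div_ne_zero one_ne_zero (sqrt_pos.2 (B_pos ha _)).ne'

theorem exists_hasEigenvaluesLE (ha : 1 / 2 < a) : ∃ x, HasEigenvaluesLE 0 a 3 x := by
  have hb := (s₀_spec ha).1
  obtain ⟨k₀, -, p₀, u₀, h₀, n₀⟩ := exists_eigenfunction ha 0
  obtain ⟨k₁, l₁, p₁, u₁, h₁, n₁⟩ := exists_eigenfunction ha k₀
  obtain ⟨k₂, l₂, p₂, u₂, h₂, n₂⟩ := exists_eigenfunction ha k₁
  have e₁ : k₀ ^ 2 < k₁ ^ 2 := by gcongr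
  have e₂ : k₁ ^ 2 < k₂ ^ 2 := by gcongr
  set ev : Fin 3 → ℝ := ![k₀ ^ 2, k₁ ^ 2, k₂ ^ 2] with hev
  set u : Fin 3 → ℝ → ℝ := ![u₀, u₁, u₂] with hu
  have hE : ∀ i, IsEigenfunction 0 a (ev i) (u i) := by
    intro i
    fin_cases i
    exacts [h₀, h₁, h₂]
  have hn : ∀ i, u i (-s₀ a) ≠ 0 := by
    intro i
    fin_cases i
    exacts [n₀, n₁, n₂]
  have hlt : ∀ i j, i ≠ j → ev i ≠ ev j := by
    intro i j hij
    fin_cases i <;> fin_cases j <;> simp [hev] at hij ⊢ <;> intro h <;> linarith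
  refine ⟨k₂ ^ 2, ev, u, fun i => ⟨?_, hE i⟩, ?_⟩
  · fin_cases i
    · exact (e₁.trans e₂).le
    · exact e₂.le
    · exact le_rfl
  · rw [Fintype.linearIndependent_iff]
    intro c hc j
    have hz : radInner a (fun s => ∑ i, c i * u i s) (u j) = 0 := by
      rw [radInner]
      refine (intervalIntegral.integral_congr (g := fun _ => 0) fun s hs => ?_).trans (by simp)
      rw [uIcc_of_le (by linarith)] at hs
      have := congrFun hc ⟨s, hs⟩
      simp only [Finset.sum_apply, Pi.smul_apply, smul_eq_mul, Pi.zero_apply] at this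
      have h0 : ∑ i, c i * u i s = 0 := this
      simp [h0]
    rw [radInner_sum_left ha c (fun i => (hE i).1.continuousOn) (hE j).1.continuousOn,
      Finset.sum_eq_single j (fun i _ hij => by
        rw [(hE i).radInner_eq_zero (hE j) (hlt i j hij), mul_zero]) (by simp)] at hz
    exact (mul_eq_zero.1 hz).resolve_right
      (radInner_self_pos ha (hE j).1.continuousOn ⟨le_rfl, by linarith⟩ (hn j)).ne'

end Existence

end HypCatenoid

end

theorem mainTheorem5 (a : ℝ) (ha : 1 / 2 < a)
    (hG : 2 * HypCatenoid.K a < Real.sinh (HypCatenoid.radius a))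
    (hpos : ∀ s ∈ Set.Icc 0 (HypCatenoid.s₀ a), 0 < HypCatenoid.paramJacobi a s 0) :
    DifferentiableAt ℝ HypCatenoid.radius a ∧ 0 < deriv HypCatenoid.radius a ∧
      0 < HypCatenoid.eigenvalue 0 a 2 := by
  have hj : ∀ s ∈ Set.Icc 0 (HypCatenoid.s₀ a), 0 < HypCatenoid.jac a s := fun s hs => by
    rw [← HypCatenoid.paramJacobi_eq ha s 0]
    exact hpos s hs
  have hs := (HypCatenoid.s₀_spec ha).1
  obtain ⟨h1, h2⟩ :=
    HypCatenoid.radius_hasDerivAt_pos ha (hj _ (Set.right_mem_Icc.2 hs.le)).le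
  obtain ⟨δ, hδ, hgap⟩ := HypCatenoid.exists_dirichlet_gap ha hj
  exact ⟨h1, h2, hδ.trans_le (le_csInf (HypCatenoid.exists_hasEigenvaluesLE ha) fun x hx =>
    HypCatenoid.le_of_hasEigenvaluesLE ha hgap hx)⟩
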